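/- Let $q\ge 2$ be a prime power, let $\mathbb{F}_q$ be the finite field with $q$ elements, and let $\mathcal{P}$ be the set of monic irreducible polynomials in $\mathbb{F}_q[t]$. For nonzero $f\in\mathbb{F}_q[t]$ let $\Omega(f)$ be the number of monic irreducible polynomials dividing $f$, counted with multiplicity, and let $$N(n,k)=\#\{f\in\mathbb{F}_q[t] : f \text{ monic},\ \deg f=n,\ \Omega(f)=k\}.$$ For complex $z$ with $|z|<q$ the product in $$H(z)=\frac{1}{\Gamma(z+1)}\prod_{p\in\mathcal{P}}\left(1-\frac{1}{q^{\deg p}}\right)^{z}\left(1-\frac{z}{q^{\deg p}}\right)^{-1}$$ converges unconditionally (that is, the finite partial products converge along the directed set of finite subsets of $\mathcal P$), and for every fixed $q$ and every $\varepsilon\in(0,q)$, as $n\to\infty$, $$N(n,k)\sim\frac{q^n}{n}\,H\!\left(\frac{k}{\log n}\right)\frac{(\log n)^{k-1}}{(k-1)!}$$ uniformly for integers $1\le k\le (q-\varepsilon)\log n$. That is: for every $\delta>0$ there is $n_0$, depending only on $q,\varepsilon,\delta$, such that for all $n\ge n_0$ and all integers $k$ with $1\le k\le(q-\varepsilon)\log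 n$, the ratio of the left-hand side to the right-hand side differs from $1$ by less than $\delta$ in absolute value. -/

import Mathlib

open Polynomial

/-- The number of monic irreducible polynomials dividing `f`, counted with multiplicity
(for `f ≠ 0`): the normalized irreducible factors of a polynomial over a field are its monic
irreducible factors. -/
noncomputable def polyOmega {F : Type*} [Field F] (f : F[X]) : ℕ := by
  classical
  exact (UniqueFactorizationMonoid.normalizedFactors f).card

/-- The set of monic polynomials of degree `n` with exactly `k` monic irreducible factors,
counted with multiplicity. -/
def monicWithOmega (F : Type*) [Field F] (n k : ℕ) : Set F[X] :=
  {f | f.Monic ∧ f.natDegree = n ∧ polyOmega f = k}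

/-- Over a finite field the set counted below is finite, so its `ncard` is its cardinality. -/
theorem monicWithOmega_finite (F : Type*) [Field F] [Fintype F] (n k : ℕ) :
    (monicWithOmega F n k).Finite := by
  have hfin : Finite (Polynomial.degreeLT F (n + 1)) :=
    Finite.of_equiv _ (Polynomial.degreeLTEquiv F (n + 1)).toEquiv.symm
  refine (Set.toFinite (Polynomial.degreeLT F (n + 1) : Set F[X])).subset ?_
  rintro f ⟨hf, hn, -⟩
  rw [SetLike.mem_coe, Polynomial.mem_degreeLT, Polynomial.degree_eq_natDegree hf.ne_zero, hn]
  exact_mod_cast Nat.lt_succ_self n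

/-- `N(n, k)`: the number of monic polynomials of degree `n` with exactly `k` monic irreducible
factors, counted with multiplicity. -/
noncomputable def numMonicWithOmega (F : Type*) [Field F] (n k : ℕ) : ℕ :=
  (monicWithOmega F n k).ncard

/-- The monic irreducible polynomials. -/
abbrev MonicIrreducible (F : Type*) [Field F] : Type _ :=
  {p : F[X] // p.Monic ∧ Irreducible p}

/-- The local factor `(1 - q^{-deg p})^z (1 - z q^{-deg p})⁻¹`, where `q = #F`. The base of the
complex power is a positive real number. -/
noncomputable def localFactor (F : Type*) [Field F] [Fintype F] (z : ℂ)
    (p : MonicIrreducible F) : ℂ :=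
  (1 - 1 / (Fintype.card F : ℂ) ^ p.1.natDegree) ^ z *
    (1 - z / (Fintype.card F : ℂ) ^ p.1.natDegree)⁻¹

/-- `H(z) = Γ(z+1)⁻¹ ∏_p (1 - q^{-deg p})^z (1 - z q^{-deg p})⁻¹`. Mathlib's `Complex.Gamma`
vanishes at its poles, so `(Complex.Gamma (z + 1))⁻¹` is the entire function `1 / Γ(z+1)`. -/
noncomputable def satheSelbergH (F : Type*) [Field F] [Fintype F] (z : ℂ) : ℂ :=
  (Complex.Gamma (z + 1))⁻¹ * ∏' p : MonicIrreducible F, localFactor F z p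

/-!
The proof is the Selberg-Delange method, carried out on coefficients.

*The generating series in `u`.* Put `A(u) = ∑ z ^ Ω(f) u ^ deg f`, summed over monic `f`. Writing
`deg f` as a sum of `deg p` over the prime powers dividing `f` gives `u A' = Λ_z A`, where the
coefficient of `u ^ n` in `Λ_z` is a sum of `deg p * z ^ r` over the prime powers `p ^ r` of
degree `n` (`eval_omegaPoly_recurrence`). For `z = 1` it is `q ^ n` (`twistedMangoldt_one`), hence
for general `z` it is `z q ^ n` plus a sum over proper prime powers, which is `O((q θ) ^ n)` with
`θ < 1`, uniformly for `‖z‖ ≤ ρ < q` (`exists_sum_norm_logFactorTerm_le`). Thus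
`A(u / q) = (1 - u) ^ (-z) G(u)`, where `G` is the exponential of a power series of radius greater
than `1`; its coefficients decay geometrically (`norm_le_of_recurrence`), and `G(1)` is the Euler
product in `H(z)` (`tsum_eq_exp_of_recurrence`, `hasProd_localFactor`), which in particular
converges and is bounded away from `0`.

*The coefficient of `u ^ n`.* Convolving the coefficients of `G` with those of `(1 - u) ^ (-z)`,
which Euler's limit formula compares with `n ^ (z - 1) / Γ(z)`, shows that
`F_n(z) = n q ^ (-n) z⁻¹ n ^ (-z) ∑_{deg f = n} z ^ Ω(f)` converges to `H(z)` and stays bounded on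
`‖z‖ = ρ` (`tendsto_normalizedOmega`, `exists_norm_normalizedOmega_le`).

*The coefficient of `z ^ k`.* Let `L = log n` and `m = k - 1`. As `F_n(z) exp(L z)` is a polynomial
with coefficients `n q ^ (-n) N(n, k)`, the quotient of `N(n, k)` by
`q ^ n / n * L ^ m / m!` is `∑ f_s m (m - 1) ⋯ (m - s + 1) / L ^ s`, with `f_s` the Taylor
coefficients of `F_n` (`numMonicWithOmega_ratio`). By Cauchy's formula `f_s` is `O(ρ ^ (-s))` and
converges to the Taylor coefficient of `H`, while the other factor differs from `(k / L) ^ s` by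
`O(1 / L)`. Dominated convergence, uniform in `k ≤ (q - ε) L` once `q - ε < ρ`, gives `H(k / L)`
(`tendsto_tsum_descFactorial`).
-/

open Filter Topology

/-! ### Counting monic polynomials by their prime powers -/

section

variable {F : Type*} [Field F]

theorem MonicIrreducible.natDegree_pos (p : MonicIrreducible F) : 0 < p.1.natDegree :=
  p.2.2.natDegree_pos

open Classical in
theorem pow_succ_dvd_iff_lt_count {f : F[X]} (hf : f ≠ 0) (p : MonicIrreducible F) (r : ℕ) :
    p.1 ^ (r + 1) ∣ f ↔ r < (UniqueFactorizationMonoid.normalizedFactors f).count p.1 := by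
  rw [pow_dvd_iff_le_emultiplicity,
    UniqueFactorizationMonoid.emultiplicity_eq_count_normalizedFactors p.2.2 hf,
    p.2.1.normalize_eq_self, Nat.cast_le, Nat.succ_le_iff]

theorem polyOmega_pow_mul (p : MonicIrreducible F) (r : ℕ) {g : F[X]} (hg : g ≠ 0) :
    polyOmega (p.1 ^ r * g) = r + polyOmega g := by
  classical
  simp only [polyOmega]
  rw [UniqueFactorizationMonoid.normalizedFactors_mul (pow_ne_zero _ p.2.2.ne_zero) hg,
    UniqueFactorizationMonoid.normalizedFactors_pow,
    UniqueFactorizationMonoid.normalizedFactors_irreducible p.2.2]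
  simp

variable [Fintype F]

/-- The monic polynomials of degree `n` over a finite field. -/
noncomputable def monicOfDegree (F : Type*) [Field F] [Fintype F] (n : ℕ) : Finset F[X] :=
  (show {f : F[X] | f.Monic ∧ f.natDegree = n}.Finite by
    have hfin : Finite (degreeLT F n) := Finite.of_equiv _ (degreeLTEquiv F n).toEquiv.symm
    exact Finite.of_equiv _ (monicEquivDegreeLT n).symm).toFinset

theorem mem_monicOfDegree {n : ℕ} {f : F[X]} :
    f ∈ monicOfDegree F n ↔ f.Monic ∧ f.natDegree = n := by
  simp [monicOfDegree]

theorem card_monicOfDegree (n : ℕ) : (monicOfDegree F n).card = Fintype.card F ^ n := by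
  have h : Nat.card {f : F[X] // f.Monic ∧ f.natDegree = n} = Fintype.card F ^ n := by
    rw [Nat.card_congr ((monicEquivDegreeLT (R := F) n).trans (degreeLTEquiv F n).toEquiv)]
    simp [Nat.card_eq_fintype_card]
  rw [← h, ← Nat.card_eq_finsetCard]
  exact Nat.card_congr (Equiv.subtypeEquivRight fun f => mem_monicOfDegree)

open Classical in
theorem finite_monicIrreducible_natDegree_le (n : ℕ) :
    {p : MonicIrreducible F | p.1.natDegree ≤ n}.Finite := by
  have h : (((Finset.range (n + 1)).biUnion (monicOfDegree F) : Finset F[X]) : Set F[X]).Finite :=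
    Finset.finite_toSet _
  refine (h.preimage (Subtype.val_injective.injOn)).subset fun p hp => ?_
  simpa [mem_monicOfDegree, p.2.1, Nat.lt_succ_iff] using hp

/-- The pair `(p, r)` stands for the prime power `p ^ (r + 1)`; this is its degree. -/
def primePowerDegree (t : MonicIrreducible F × ℕ) : ℕ := (t.2 + 1) * t.1.1.natDegree

theorem finite_primePowerDegree_eq (n : ℕ) :
    {t : MonicIrreducible F × ℕ | primePowerDegree t = n}.Finite := by
  refine ((finite_monicIrreducible_natDegree_le n).prod (Set.finite_Iic n)).subset ?_
  rintro ⟨p, r⟩ h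
  have hp := p.natDegree_pos
  simp only [primePowerDegree, Set.mem_ofPred_eq] at h
  simp only [Set.mem_prod, Set.mem_ofPred_eq, Set.mem_Iic]
  constructor <;> nlinarith

/-- The prime powers of degree `n`, each given as a pair `(p, r)` standing for `p ^ (r + 1)`. -/
noncomputable def primePowersOfDegree (F : Type*) [Field F] [Fintype F] (n : ℕ) :
    Finset (MonicIrreducible F × ℕ) :=
  (finite_primePowerDegree_eq n).toFinset

theorem mem_primePowersOfDegree {n : ℕ} {t : MonicIrreducible F × ℕ} :
    t ∈ primePowersOfDegree F n ↔ primePowerDegree t = n := by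
  simp [primePowersOfDegree]

theorem primePowersOfDegree_zero : primePowersOfDegree F 0 = ∅ := by
  ext t
  have := t.1.natDegree_pos
  simp [mem_primePowersOfDegree, primePowerDegree, this.ne']

open Classical in
/-- The degree of a polynomial is the sum of `deg p` over the prime powers dividing it: the
polynomial counterpart of `log = Λ * 1`. -/
theorem sum_natDegree_primePower_dvd {n : ℕ} {f : F[X]} (hf : f ∈ monicOfDegree F n) :
    ∑ m ∈ Finset.range (n + 1), ∑ t ∈ primePowersOfDegree F m,
      (if t.1.1 ^ (t.2 + 1) ∣ f then t.1.1.natDegree else 0) = n := by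
  obtain ⟨hm, hn⟩ := mem_monicOfDegree.1 hf
  set s := UniqueFactorizationMonoid.normalizedFactors f with hs
  have hmem : ∀ p ∈ s, p.Monic ∧ Irreducible p := fun p hp => by
    have hi := UniqueFactorizationMonoid.irreducible_of_normalized_factor p hp
    refine ⟨?_, hi⟩
    rw [← UniqueFactorizationMonoid.normalize_normalized_factor p hp]
    exact monic_normalize hi.ne_zero
  have hprod : s.prod = f := by
    rw [hs, UniqueFactorizationMonoid.prod_normalizedFactors_eq hm.ne_zero, hm.normalize_eq_self]
  have hdeg : ∑ p ∈ s.toFinset, ∑ r ∈ Finset.range (s.count p), p.natDegree = n := by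
    rw [← hn, ← hprod, natDegree_multiset_prod_of_monic _ fun p hp => (hmem p hp).1,
      Finset.sum_multiset_map_count]
    simp
  refine Eq.trans ?_ hdeg
  rw [Finset.sum_sigma', Finset.sum_sigma']
  rw [← Finset.sum_filter_add_sum_filter_not _
    (fun x : (_ : ℕ) × (MonicIrreducible F × ℕ) => x.2.1.1 ^ (x.2.2 + 1) ∣ f)]
  rw [Finset.sum_eq_zero (s := Finset.filter (fun x => ¬ _) _)
    (fun x hx => if_neg (Finset.mem_filter.1 hx).2), add_zero]
  refine Finset.sum_bij (fun x _ => ⟨x.2.1.1, x.2.2⟩) ?_ ?_ ?_ ?_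
  · rintro ⟨m, p, r⟩ hx
    simp only [Finset.mem_filter, Finset.mem_sigma, pow_succ_dvd_iff_lt_count hm.ne_zero] at hx
    simp only [Finset.mem_sigma, Multiset.mem_toFinset, Finset.mem_range]
    exact ⟨Multiset.count_pos.1 (pos_of_gt hx.2), hx.2⟩
  · rintro ⟨m, p, r⟩ hx ⟨m', p', r'⟩ hx' h
    simp only [Finset.mem_filter, Finset.mem_sigma, mem_primePowersOfDegree] at hx hx'
    simp only [Sigma.mk.injEq, heq_eq_eq] at h
    obtain ⟨h1, rfl⟩ := h
    obtain rfl := Subtype.ext h1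
    rw [← hx.1.2, ← hx'.1.2]
  · rintro ⟨p, r⟩ hx
    simp only [Finset.mem_sigma, Multiset.mem_toFinset, Finset.mem_range] at hx
    have hd := (pow_succ_dvd_iff_lt_count hm.ne_zero ⟨p, hmem p hx.1⟩ r).2 hx.2
    refine ⟨⟨primePowerDegree (⟨p, hmem p hx.1⟩, r), ⟨p, hmem p hx.1⟩, r⟩, ?_, rfl⟩
    simp only [Finset.mem_filter, Finset.mem_sigma, mem_primePowersOfDegree, Finset.mem_range]
    refine ⟨⟨?_, trivial⟩, hd⟩
    have := natDegree_le_of_dvd hd hm.ne_zero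
    rw [natDegree_pow, hn] at this
    simpa [primePowerDegree, Nat.lt_succ_iff] using this
  · rintro ⟨m, p, r⟩ hx
    rw [if_pos (Finset.mem_filter.1 hx).2]

/-- `∑ z ^ Ω(f)` over the monic polynomials `f` of degree `n`, as a polynomial in `z`. -/
noncomputable def omegaPoly (F : Type*) [Field F] [Fintype F] (n : ℕ) : ℂ[X] :=
  ∑ f ∈ monicOfDegree F n, X ^ polyOmega f

theorem eval_omegaPoly (n : ℕ) (z : ℂ) :
    (omegaPoly F n).eval z = ∑ f ∈ monicOfDegree F n, z ^ polyOmega f := by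
  simp [omegaPoly, eval_finsetSum]

theorem coeff_omegaPoly (n k : ℕ) :
    (omegaPoly F n).coeff k = numMonicWithOmega F n k := by
  classical
  have : numMonicWithOmega F n k =
      ((monicOfDegree F n).filter (fun f => polyOmega f = k)).card := by
    rw [numMonicWithOmega, ← Set.ncard_coe_finset]
    congr 1
    ext f
    simp [monicWithOmega, mem_monicOfDegree, and_assoc]
  simp [omegaPoly, coeff_X_pow, this, eq_comm]

theorem eval_omegaPoly_zero_left (z : ℂ) : (omegaPoly F 0).eval z = 1 := by
  have : monicOfDegree F 0 = {1} := by
    ext f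
    rw [mem_monicOfDegree, Finset.mem_singleton]
    constructor
    · rintro ⟨h1, h2⟩
      exact h1.natDegree_eq_zero.1 h2
    · rintro rfl
      simp
  rw [eval_omegaPoly, this]
  simp [polyOmega]

theorem numMonicWithOmega_zero_right {n : ℕ} (hn : n ≠ 0) : numMonicWithOmega F n 0 = 0 := by
  classical
  rw [numMonicWithOmega, Set.ncard_eq_zero (monicWithOmega_finite F n 0),
    Set.eq_empty_iff_forall_notMem]
  rintro f ⟨hm, hd, ho⟩
  simp only [polyOmega, Multiset.card_eq_zero] at ho
  have h := UniqueFactorizationMonoid.prod_normalizedFactors_eq hm.ne_zero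
  rw [ho, hm.normalize_eq_self, Multiset.prod_zero] at h
  rw [← h] at hd
  simp at hd
  exact hn hd.symm

/-- The coefficient of `u ^ n` in `u` times the logarithmic derivative in `u` of
`∑ z ^ Ω(f) u ^ deg f`. -/
noncomputable def twistedMangoldt (F : Type*) [Field F] [Fintype F] (z : ℂ) (n : ℕ) : ℂ :=
  ∑ t ∈ primePowersOfDegree F n, (t.1.1.natDegree : ℂ) * z ^ (t.2 + 1)

theorem sum_pow_polyOmega_of_dvd {n : ℕ} (z : ℂ) {t : MonicIrreducible F × ℕ}
    [DecidablePred fun f : F[X] => t.1.1 ^ (t.2 + 1) ∣ f]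
    (ht : primePowerDegree t ≤ n) :
    ∑ f ∈ monicOfDegree F n with t.1.1 ^ (t.2 + 1) ∣ f, z ^ polyOmega f =
      z ^ (t.2 + 1) * (omegaPoly F (n - primePowerDegree t)).eval z := by
  have hpm : (t.1.1 ^ (t.2 + 1)).Monic := t.1.2.1.pow _
  have hpd : (t.1.1 ^ (t.2 + 1)).natDegree = primePowerDegree t := natDegree_pow _ _
  rw [eval_omegaPoly, Finset.mul_sum]
  symm
  refine Finset.sum_bij (fun g _ => t.1.1 ^ (t.2 + 1) * g) ?_ ?_ ?_ ?_
  · intro g hg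
    rw [mem_monicOfDegree] at hg
    rw [Finset.mem_filter, mem_monicOfDegree, hpm.natDegree_mul hg.1, hpd, hg.2]
    exact ⟨⟨hpm.mul hg.1, by omega⟩, dvd_mul_right _ _⟩
  · intro g _ g' _ h
    exact mul_left_cancel₀ hpm.ne_zero h
  · intro f hf
    rw [Finset.mem_filter, mem_monicOfDegree] at hf
    obtain ⟨⟨h1, h2⟩, g, rfl⟩ := hf
    have hg := hpm.of_mul_monic_left h1
    refine ⟨g, ?_, rfl⟩
    rw [hpm.natDegree_mul hg, hpd] at h2
    exact mem_monicOfDegree.2 ⟨hg, by omega⟩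
  · intro g hg
    rw [polyOmega_pow_mul _ _ (mem_monicOfDegree.1 hg).1.ne_zero, pow_add z (t.2 + 1)]

open Classical in
/-- The coefficient form of `u A' = L A`, for `A = ∑ z ^ Ω(f) u ^ deg f` and its logarithmic
derivative: sum `deg f * z ^ Ω(f)`, write `deg f` as a sum over the prime powers
dividing `f`, and interchange. -/
theorem eval_omegaPoly_recurrence (z : ℂ) (n : ℕ) :
    ((n + 1 : ℕ) : ℂ) * (omegaPoly F (n + 1)).eval z =
      ∑ ij ∈ Finset.HasAntidiagonal.antidiagonal n,
        twistedMangoldt F z (ij.1 + 1) * (omegaPoly F ij.2).eval z := by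
  have h1 : ((n + 1 : ℕ) : ℂ) * (omegaPoly F (n + 1)).eval z =
      ∑ m ∈ Finset.range (n + 2), twistedMangoldt F z m * (omegaPoly F (n + 1 - m)).eval z := by
    calc ((n + 1 : ℕ) : ℂ) * (omegaPoly F (n + 1)).eval z
        = ∑ f ∈ monicOfDegree F (n + 1), ∑ m ∈ Finset.range (n + 2),
            ∑ t ∈ primePowersOfDegree F m,
              (if t.1.1 ^ (t.2 + 1) ∣ f then (t.1.1.natDegree : ℂ) * z ^ polyOmega f else 0) := by
          rw [eval_omegaPoly, Finset.mul_sum]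
          refine Finset.sum_congr rfl fun f hf => ?_
          conv_lhs => rw [← sum_natDegree_primePower_dvd hf]
          push_cast
          simp only [Finset.sum_mul]
          refine Finset.sum_congr rfl fun m _ => Finset.sum_congr rfl fun t _ => ?_
          split_ifs <;> simp
      _ = ∑ m ∈ Finset.range (n + 2), ∑ t ∈ primePowersOfDegree F m,
            (t.1.1.natDegree : ℂ) *
              ∑ f ∈ monicOfDegree F (n + 1) with t.1.1 ^ (t.2 + 1) ∣ f, z ^ polyOmega f := by
          rw [Finset.sum_comm]
          refine Finset.sum_congr rfl fun m _ => ?_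
          rw [Finset.sum_comm]
          refine Finset.sum_congr rfl fun t _ => ?_
          rw [Finset.mul_sum, Finset.sum_filter]
      _ = _ := by
          refine Finset.sum_congr rfl fun m hm => ?_
          rw [twistedMangoldt, Finset.sum_mul]
          refine Finset.sum_congr rfl fun t ht => ?_
          rw [mem_primePowersOfDegree] at ht
          rw [sum_pow_polyOmega_of_dvd z (ht.trans_le (Nat.lt_succ_iff.1 (Finset.mem_range.1 hm))),
            ht, mul_assoc]
  rw [h1, Finset.sum_range_succ', Finset.Nat.sum_antidiagonal_eq_sum_range_succ
    (fun i j => twistedMangoldt F z (i + 1) * (omegaPoly F j).eval z)]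
  simp [twistedMangoldt, primePowersOfDegree_zero]

/-- There are `q ^ n` monic polynomials of degree `n`; through the recurrence at `z = 1` this is
the prime number theorem `∑_{d ∣ n} d π_d = q ^ n` for polynomials. -/
theorem twistedMangoldt_one (n : ℕ) :
    twistedMangoldt F 1 (n + 1) = (Fintype.card F : ℂ) ^ (n + 1) := by
  have hev : ∀ m, (omegaPoly F m).eval 1 = (Fintype.card F : ℂ) ^ m := fun m => by
    simp [eval_omegaPoly, card_monicOfDegree]
  induction n using Nat.strong_induction_on with
  | _ n ih =>
    have h := eval_omegaPoly_recurrence (F := F) 1 n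
    rw [Finset.Nat.sum_antidiagonal_eq_sum_range_succ
      (fun i j => twistedMangoldt F 1 (i + 1) * (omegaPoly F j).eval 1), Finset.sum_range_succ,
      Finset.sum_congr rfl (g := fun _ => (Fintype.card F : ℂ) ^ (n + 1))] at h
    · simp only [Finset.sum_const, Finset.card_range, hev, Nat.sub_self, pow_zero, mul_one,
        nsmul_eq_mul] at h
      push_cast at h
      linear_combination -h
    · intro i hi
      rw [Finset.mem_range] at hi
      rw [ih i hi, hev, ← pow_add]
      congr 1
      omega

/-! ### Power series with a given logarithmic derivative -/

/-- The coefficient `z (z + 1) ⋯ (z + n - 1) / n!` of `u ^ n` in `(1 - u) ^ (-z)`. -/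
noncomputable def risingBinom {K : Type*} [Field K] (z : K) (n : ℕ) : K :=
  ∏ i ∈ Finset.range n, (z + i) / (i + 1)

theorem risingBinom_zero_right {K : Type*} [Field K] (z : K) : risingBinom z 0 = 1 := by
  simp [risingBinom]

theorem risingBinom_succ {K : Type*} [Field K] (z : K) (n : ℕ) :
    risingBinom z (n + 1) = risingBinom z n * ((z + n) / (n + 1)) :=
  Finset.prod_range_succ _ _

theorem sum_risingBinom {K : Type*} [Field K] [CharZero K] (z : K) (n : ℕ) :
    z * ∑ j ∈ Finset.range (n + 1), risingBinom z j = (n + 1) * risingBinom z (n + 1) := by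
  induction n with
  | zero => simp [risingBinom]
  | succ n ih =>
    have h : (n : K) + 1 + 1 ≠ 0 := by exact_mod_cast (n + 1).succ_ne_zero
    rw [Finset.sum_range_succ, mul_add, ih, risingBinom_succ z (n + 1)]
    push_cast
    field_simp
    ring

theorem sum_antidiagonal_snd {K : Type*} [AddCommMonoid K] (f : ℕ → K) (n : ℕ) :
    ∑ ij ∈ Finset.HasAntidiagonal.antidiagonal n, f ij.2 = ∑ j ∈ Finset.range (n + 1), f j := by
  rw [Finset.Nat.sum_antidiagonal_eq_sum_range_succ (fun _ j => f j)]
  simpa using Finset.sum_range_reflect f (n + 1)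

theorem risingBinom_natCast_le (M n : ℕ) : risingBinom (M : ℝ) n ≤ (n + 1) ^ M := by
  induction n with
  | zero => simp [risingBinom]
  | succ n ih =>
    have hb : ((M : ℝ) + n) / (n + 1) ≤ (((n : ℝ) + 2) / (n + 1)) ^ M := by
      have h1 : ((n : ℝ) + 2) / (n + 1) = 1 + 1 / (n + 1) := by field_simp; ring
      have h2 : (-2 : ℝ) ≤ 1 / (n + 1) := (by norm_num : (-2 : ℝ) ≤ 0).trans (by positivity)
      rw [h1]
      refine le_trans ?_ (one_add_mul_le_pow h2 M)
      rw [div_le_iff₀ (by positivity)]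
      field_simp
      linarith
    rw [risingBinom_succ]
    calc _ ≤ ((n : ℝ) + 1) ^ M * (((n : ℝ) + 2) / (n + 1)) ^ M := by gcongr
      _ = _ := by
        rw [← mul_pow]
        congr 1
        push_cast
        field_simp
        ring

/-- The power series `(1 - u) ^ (-z)`. -/
noncomputable def risingSeries (z : ℂ) : PowerSeries ℂ := PowerSeries.mk (risingBinom z)

theorem derivative_risingSeries (z : ℂ) :
    PowerSeries.derivative ℂ (risingSeries z) =
      PowerSeries.mk (fun _ => z) * risingSeries z := by
  ext n
  rw [PowerSeries.coeff_derivative, PowerSeries.coeff_mul, risingSeries]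
  simp only [PowerSeries.coeff_mk]
  rw [sum_antidiagonal_snd (fun j => z * risingBinom z j), ← Finset.mul_sum, sum_risingBinom,
    mul_comm]

theorem risingSeries_mul_neg (z : ℂ) : risingSeries z * risingSeries (-z) = 1 := by
  refine PowerSeries.derivative.ext ?_ ?_
  · rw [Derivation.leibniz, derivative_risingSeries, derivative_risingSeries,
      PowerSeries.derivative_one]
    have : PowerSeries.mk (fun _ : ℕ => -z) = -PowerSeries.mk (fun _ => z) := by ext; simp
    rw [this]
    simp only [smul_eq_mul]
    ring
  · simp [risingSeries, risingBinom_zero_right]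

/-- A solution of the recurrence `(n + 1) γ (n + 1) = ∑ l i * γ j` is majorized by the solution
`(1 - θ u) ^ (-M)` for the majorant `M θ ^ (i + 1)` of `l`. -/
theorem norm_le_of_recurrence {l γ : ℕ → ℂ} {M : ℕ} {θ : ℝ} (hθ : 0 ≤ θ) (h0 : γ 0 = 1)
    (hγ : ∀ n : ℕ, ((n : ℂ) + 1) * γ (n + 1) =
      ∑ ij ∈ Finset.HasAntidiagonal.antidiagonal n, l ij.1 * γ ij.2)
    (hl : ∀ i, ‖l i‖ ≤ M * θ ^ (i + 1)) (n : ℕ) : ‖γ n‖ ≤ (n + 1) ^ M * θ ^ n := by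
  suffices h : ‖γ n‖ ≤ risingBinom (M : ℝ) n * θ ^ n from
    h.trans (by gcongr; exact risingBinom_natCast_le M n)
  induction n using Nat.strong_induction_on with
  | _ n ih =>
    cases n with
    | zero => simp [h0, risingBinom_zero_right]
    | succ n =>
      have hn : (0 : ℝ) < n + 1 := by positivity
      refine le_of_mul_le_mul_left ?_ hn
      calc ((n : ℝ) + 1) * ‖γ (n + 1)‖ = ‖((n : ℂ) + 1) * γ (n + 1)‖ := by
            rw [norm_mul]; congr 1; norm_cast
        _ ≤ ∑ ij ∈ Finset.HasAntidiagonal.antidiagonal n,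
              (M * θ ^ (ij.1 + 1)) * (risingBinom (M : ℝ) ij.2 * θ ^ ij.2) := by
            rw [hγ]
            refine norm_sum_le_of_le _ fun ij hij => ?_
            rw [norm_mul]
            have := Finset.HasAntidiagonal.mem_antidiagonal.1 hij
            exact mul_le_mul (hl _) (ih _ (by omega)) (norm_nonneg _) (by positivity)
        _ = ∑ ij ∈ Finset.HasAntidiagonal.antidiagonal n,
              (M * risingBinom (M : ℝ) ij.2) * θ ^ (n + 1) := by
            refine Finset.sum_congr rfl fun ij hij => ?_
            rw [← Finset.HasAntidiagonal.mem_antidiagonal.1 hij]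
            ring
        _ = _ := by
            rw [sum_antidiagonal_snd (fun j => (M * risingBinom (M : ℝ) j) * θ ^ (n + 1)),
              ← Finset.sum_mul, ← Finset.mul_sum, sum_risingBinom]
            ring

theorem summable_succ_pow_mul_geometric (k : ℕ) {x : ℝ} (h0 : 0 < x) (h1 : x < 1) :
    Summable fun n : ℕ => ((n : ℝ) + 1) ^ k * x ^ n := by
  have h := (summable_nat_add_iff 1).2
    (summable_pow_mul_geometric_of_norm_lt_one k (r := x) (by rwa [Real.norm_of_nonneg h0.le]))
  refine (h.mul_right x⁻¹).congr fun n => ?_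
  push_cast
  rw [pow_succ]
  field_simp

theorem hasDerivAt_tsum_pow {c : ℕ → ℂ} {R : ℝ}
    (h : Summable fun n : ℕ => ((n : ℝ) + 1) * ‖c (n + 1)‖ * R ^ n) {x : ℂ} (hx : ‖x‖ < R) :
    HasDerivAt (fun y : ℂ => ∑' n, c n * y ^ n)
      (∑' n : ℕ, ((n : ℂ) + 1) * c (n + 1) * x ^ n) x := by
  have hR : 0 < R := (norm_nonneg x).trans_lt hx
  have hu : Summable fun n : ℕ => (n : ℝ) * ‖c n‖ * R ^ (n - 1) := by
    rw [← summable_nat_add_iff 1]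
    simpa using h
  have hd : ∀ n, ∀ y ∈ Metric.ball (0 : ℂ) R, ‖c n * (n * y ^ (n - 1))‖ ≤
      (n : ℝ) * ‖c n‖ * R ^ (n - 1) := fun n y hy => by
    rw [mem_ball_zero_iff] at hy
    rw [norm_mul, norm_mul, norm_pow, Complex.norm_natCast, mul_left_comm, ← mul_assoc]
    gcongr
  have key := hasDerivAt_tsum_of_isPreconnected (g := fun n (y : ℂ) => c n * y ^ n)
    (g' := fun n y => c n * (n * y ^ (n - 1))) (y₀ := 0) hu Metric.isOpen_ball
    (convex_ball (0 : ℂ) R).isPreconnected (fun n y _ => (hasDerivAt_pow n y).const_mul (c n)) hd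
    (Metric.mem_ball_self hR)
    (summable_of_ne_finset_zero (s := {0}) fun n hn => by
      simp [Finset.mem_singleton.not.1 hn]) (mem_ball_zero_iff.2 hx)
  refine key.congr_deriv ?_
  have hs : Summable fun n => c n * (n * x ^ (n - 1)) :=
    Summable.of_norm_bounded hu fun n => hd n x (mem_ball_zero_iff.2 hx)
  rw [hs.tsum_eq_zero_add]
  simp only [Nat.cast_zero, zero_mul, mul_zero, zero_add]
  refine tsum_congr fun n => ?_
  push_cast
  ring

/-- The solution of the recurrence `(n + 1) γ (n + 1) = ∑ l i * γ j` is the coefficient sequence of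
`exp (∑ l i / (i + 1) * x ^ (i + 1))`, here evaluated at `x = 1`:
both are solutions of `g' = (∑ l i * x ^ i) g` on a disc of radius greater than `1`. -/
theorem tsum_eq_exp_of_recurrence {l γ : ℕ → ℂ} {M : ℕ} {θ : ℝ} (hθ : 0 < θ) (hθ1 : θ < 1)
    (h0 : γ 0 = 1)
    (hγ : ∀ n : ℕ, ((n : ℂ) + 1) * γ (n + 1) =
      ∑ ij ∈ Finset.HasAntidiagonal.antidiagonal n, l ij.1 * γ ij.2)
    (hl : ∀ i, ‖l i‖ ≤ M * θ ^ (i + 1)) :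
    ∑' n, γ n = Complex.exp (∑' i : ℕ, l i / (i + 1)) := by
  have hb := norm_le_of_recurrence hθ.le h0 hγ hl
  obtain ⟨R, hR1, hR2⟩ : ∃ R : ℝ, 1 < R ∧ θ * R < 1 := by
    obtain ⟨R, h1, h2⟩ := exists_between (one_lt_one_div hθ hθ1)
    exact ⟨R, h1, by rwa [lt_div_iff₀ hθ, mul_comm] at h2⟩
  have hR0 : 0 < R := one_pos.trans hR1
  have hsl : Summable fun n => ‖l n‖ * R ^ n := by
    refine Summable.of_nonneg_of_le (fun n => by positivity) (fun n => ?_)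
      ((summable_geometric_of_lt_one (by positivity : 0 ≤ θ * R) hR2).mul_left (M * θ))
    calc _ ≤ (M * θ ^ (n + 1)) * R ^ n := by gcongr; exact hl n
      _ = _ := by rw [mul_pow]; ring
  have hsγ : Summable fun n => ‖γ n‖ * R ^ n := by
    refine Summable.of_nonneg_of_le (fun n => by positivity) (fun n => ?_)
      (summable_succ_pow_mul_geometric M (by positivity : 0 < θ * R) hR2)
    calc _ ≤ (((n : ℝ) + 1) ^ M * θ ^ n) * R ^ n := by gcongr; exact hb n
      _ = _ := by rw [mul_pow]; ring
  have hsγ' : Summable fun n : ℕ => ((n : ℝ) + 1) * ‖γ (n + 1)‖ * R ^ n := by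
    refine Summable.of_nonneg_of_le (fun n => by positivity) (fun n => ?_)
      ((summable_succ_pow_mul_geometric (M + 1) (by positivity : 0 < θ * R) hR2).mul_left
        (2 ^ M * θ))
    calc ((n : ℝ) + 1) * ‖γ (n + 1)‖ * R ^ n
        ≤ ((n : ℝ) + 1) * ((2 * (n + 1)) ^ M * θ ^ (n + 1)) * R ^ n := by
          gcongr
          refine (hb (n + 1)).trans ?_
          gcongr
          push_cast
          have : (0 : ℝ) ≤ n := by positivity
          linarith
      _ = _ := by rw [mul_pow, mul_pow]; ring
  -- The coefficients of the exponent, so that `S` below has derivative `∑ l i * x ^ i`.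
  set c : ℕ → ℂ := fun n => if n = 0 then 0 else l (n - 1) / n with hc
  have hc1 : ∀ n : ℕ, ((n : ℂ) + 1) * c (n + 1) = l n := fun n => by
    have : (n : ℂ) + 1 ≠ 0 := by exact_mod_cast n.succ_ne_zero
    simp only [hc, Nat.add_eq_zero_iff, one_ne_zero, and_false, if_false, Nat.add_sub_cancel]
    push_cast
    field_simp
  have hsc : Summable fun n : ℕ => ((n : ℝ) + 1) * ‖c (n + 1)‖ * R ^ n := by
    refine hsl.congr fun n => ?_
    rw [← hc1, norm_mul]
    congr 2
    norm_cast
  set g : ℂ → ℂ := fun x => ∑' n, γ n * x ^ n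
  set S : ℂ → ℂ := fun x => ∑' n, c n * x ^ n
  have hS : ∀ x ∈ Metric.ball (0 : ℂ) R, HasDerivAt S (∑' n, l n * x ^ n) x := fun x hx => by
    have := hasDerivAt_tsum_pow hsc (mem_ball_zero_iff.1 hx)
    simpa only [hc1] using this
  have hsum : ∀ x ∈ Metric.ball (0 : ℂ) R, ∀ a : ℕ → ℂ, (Summable fun n => ‖a n‖ * R ^ n) →
      Summable fun n => ‖a n * x ^ n‖ := fun x hx a ha => by
    rw [mem_ball_zero_iff] at hx
    refine Summable.of_nonneg_of_le (fun n => norm_nonneg _) (fun n => ?_) ha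
    rw [norm_mul, norm_pow]
    gcongr
  have hg : ∀ x ∈ Metric.ball (0 : ℂ) R, HasDerivAt g ((∑' n, l n * x ^ n) * g x) x :=
    fun x hx => by
    have := hasDerivAt_tsum_pow hsγ' (mem_ball_zero_iff.1 hx)
    refine this.congr_deriv ?_
    rw [tsum_mul_tsum_eq_tsum_sum_antidiagonal_of_summable_norm (hsum x hx l hsl)
      (hsum x hx γ hsγ)]
    refine tsum_congr fun n => ?_
    rw [hγ, Finset.sum_mul]
    refine Finset.sum_congr rfl fun ij hij => ?_
    rw [← Finset.HasAntidiagonal.mem_antidiagonal.1 hij, pow_add]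
    ring
  have hder : ∀ x ∈ Metric.ball (0 : ℂ) R,
      HasDerivAt (fun x => g x * Complex.exp (-S x)) 0 x := fun x hx => by
    exact ((hg x hx).fun_mul (hS x hx).fun_neg.cexp).congr_deriv (by ring)
  have hconst := Metric.isOpen_ball.is_const_of_deriv_eq_zero
    (convex_ball (0 : ℂ) R).isPreconnected
    (fun x hx => (hder x hx).differentiableAt.differentiableWithinAt)
    (fun x hx => (hder x hx).deriv) (x := 1) (y := 0)
    (by rw [mem_ball_zero_iff, norm_one]; exact hR1) (Metric.mem_ball_self hR0)
  have hz : ∀ a : ℕ → ℂ, ∑' n, a n * (0 : ℂ) ^ n = a 0 := fun a => by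
    rw [tsum_eq_single 0 fun n hn => by simp [hn]]
    simp
  have hg0 : g 0 = 1 := (hz γ).trans h0
  have hS0 : S 0 = 0 := (hz c).trans (by simp [hc])
  have hS1 : S 1 = ∑' i : ℕ, l i / (i + 1) := by
    have hsc1 : Summable fun n => c n * (1 : ℂ) ^ n := by
      rw [← summable_nat_add_iff 1]
      refine Summable.of_norm_bounded hsl fun n => ?_
      rw [← hc1, norm_mul, one_pow, norm_one, mul_one, norm_mul]
      have h1 : ‖(n : ℂ) + 1‖ = (n : ℝ) + 1 := by norm_cast
      have h2 : (1 : ℝ) ≤ (n + 1) * R ^ n :=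
        one_le_mul_of_one_le_of_one_le (by simp) (one_le_pow₀ hR1.le)
      rw [h1]
      nlinarith [norm_nonneg (c (n + 1))]
    simp only [S]
    rw [hsc1.tsum_eq_zero_add]
    simp [hc]
  have hg1 : g 1 = ∑' n, γ n := by simp [g]
  rw [← hS1, ← hg1]
  simp only [hg0, hS0, neg_zero, Complex.exp_zero, mul_one] at hconst
  rw [Complex.exp_neg, mul_inv_eq_one₀ (Complex.exp_ne_zero _)] at hconst
  exact hconst

/-! ### The Euler product -/

theorem two_le_card_real (F : Type*) [Field F] [Fintype F] : (2 : ℝ) ≤ Fintype.card F := by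
  exact_mod_cast Fintype.one_lt_card (α := F)

/-- The term of the prime power `p ^ (r + 1)`, encoded as `(p, r)`, in
`log ∏ (1 - q ^ (-deg p)) ^ z / (1 - z q ^ (-deg p))`. It vanishes at `r = 0`, which is what makes
the double series converge for `‖z‖ < q`. -/
noncomputable def logFactorTerm (F : Type*) [Field F] [Fintype F] (z : ℂ)
    (t : MonicIrreducible F × ℕ) : ℂ :=
  (z ^ (t.2 + 1) - z) / (t.2 + 1) / (Fintype.card F : ℂ) ^ primePowerDegree t

/-- For `n ≥ 1`, the coefficient of `u ^ n` in `u` times the logarithmic derivative of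
`∑ z ^ Ω(f) (u / q) ^ deg f * (1 - u) ^ z`. -/
noncomputable def mangoldtError (F : Type*) [Field F] [Fintype F] (z : ℂ) (n : ℕ) : ℂ :=
  twistedMangoldt F z n / (Fintype.card F : ℂ) ^ n - z

theorem mangoldtError_div (z : ℂ) (n : ℕ) :
    mangoldtError F z (n + 1) / ((n : ℂ) + 1) =
      ∑ t ∈ primePowersOfDegree F (n + 1), logFactorTerm F z t := by
  have hq : (Fintype.card F : ℂ) ≠ 0 := by exact_mod_cast Fintype.card_ne_zero
  have hn : (n : ℂ) + 1 ≠ 0 := by exact_mod_cast n.succ_ne_zero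
  have h1 : mangoldtError F z (n + 1) = (∑ t ∈ primePowersOfDegree F (n + 1),
      (t.1.1.natDegree : ℂ) * (z ^ (t.2 + 1) - z)) / (Fintype.card F : ℂ) ^ (n + 1) := by
    have h2 := twistedMangoldt_one (F := F) n
    simp only [twistedMangoldt, one_pow, mul_one] at h2
    simp only [mul_sub, Finset.sum_sub_distrib]
    rw [← Finset.sum_mul, h2, mangoldtError, twistedMangoldt, sub_div,
      mul_div_cancel_left₀ _ (pow_ne_zero _ hq)]
  rw [h1, Finset.sum_div, Finset.sum_div]
  refine Finset.sum_congr rfl fun t ht => ?_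
  rw [mem_primePowersOfDegree] at ht
  have h3 : ((t.2 : ℂ) + 1) * t.1.1.natDegree = n + 1 := by exact_mod_cast ht
  have h4 : (t.2 : ℂ) + 1 ≠ 0 := by exact_mod_cast t.2.succ_ne_zero
  rw [logFactorTerm, ht]
  field_simp
  linear_combination (z ^ (t.2 + 1) - z) * h3

theorem sum_primePowersOfDegree_le (n : ℕ) :
    ∑ t ∈ primePowersOfDegree F n, ((Fintype.card F : ℝ) ^ t.1.1.natDegree)⁻¹ ≤ n + 1 := by
  classical
  have hq : (Fintype.card F : ℝ) ≠ 0 := by exact_mod_cast Fintype.card_ne_zero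
  have hinj : Set.InjOn (fun t : MonicIrreducible F × ℕ =>
      (⟨t.1.1.natDegree, t.1.1⟩ : (_ : ℕ) × F[X])) (primePowersOfDegree F n) := by
    rintro ⟨p, r⟩ h ⟨p', r'⟩ h' he
    rw [Finset.mem_coe, mem_primePowersOfDegree] at h h'
    simp only [Sigma.mk.injEq, heq_eq_eq] at he
    obtain rfl := Subtype.ext he.2
    have := Nat.eq_of_mul_eq_mul_right p.natDegree_pos (h.trans h'.symm)
    simpa using this
  calc _ = ∑ x ∈ (primePowersOfDegree F n).image (fun t : MonicIrreducible F × ℕ =>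
          (⟨t.1.1.natDegree, t.1.1⟩ : (_ : ℕ) × F[X])), ((Fintype.card F : ℝ) ^ x.1)⁻¹ :=
        (Finset.sum_image hinj).symm
    _ ≤ ∑ x ∈ (Finset.range (n + 1)).sigma (monicOfDegree F), ((Fintype.card F : ℝ) ^ x.1)⁻¹ := by
        refine Finset.sum_le_sum_of_subset_of_nonneg ?_ fun _ _ _ => by positivity
        rw [Finset.image_subset_iff]
        rintro ⟨p, r⟩ h
        rw [mem_primePowersOfDegree] at h
        simp only [primePowerDegree] at h
        rw [Finset.mem_sigma, mem_monicOfDegree, Finset.mem_range]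
        refine ⟨?_, p.2.1, rfl⟩
        simp only
        nlinarith
    _ = n + 1 := by
        rw [Finset.sum_sigma]
        simp [card_monicOfDegree, hq]

/-- Among the pairs `(d, r)` with `d r = n` and `r ≥ 2`, the term `q ^ d * ρ ^ r` is largest at
`d = 1`, provided `q ≤ ρ ^ 2`. -/
theorem sum_norm_logFactorTerm_le {ρ : ℝ} (h1 : 1 ≤ ρ) (hρ : (Fintype.card F : ℝ) ≤ ρ ^ 2) {z : ℂ}
    (hz : ‖z‖ ≤ ρ) (n : ℕ) :
    ∑ t ∈ primePowersOfDegree F n, ‖logFactorTerm F z t‖ ≤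
      2 * Fintype.card F * (n + 1) * (ρ / Fintype.card F) ^ n := by
  have hq := two_le_card_real F
  have hq0 : (0 : ℝ) < Fintype.card F := by linarith
  calc ∑ t ∈ primePowersOfDegree F n, ‖logFactorTerm F z t‖
      ≤ ∑ t ∈ primePowersOfDegree F n, ((Fintype.card F : ℝ) ^ t.1.1.natDegree)⁻¹ *
          (2 * Fintype.card F * (ρ / Fintype.card F) ^ n) := by
        refine Finset.sum_le_sum fun t ht => ?_
        obtain ⟨p, r⟩ := t
        rw [mem_primePowersOfDegree] at ht
        rw [logFactorTerm, ht, norm_div, norm_div, norm_pow, Complex.norm_natCast]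
        simp only
        rcases Nat.eq_zero_or_pos r with rfl | hr
        · simp only [zero_add, pow_one, sub_self, norm_zero, zero_div]
          positivity
        obtain ⟨d, hd⟩ : ∃ d, p.1.natDegree = d + 1 := ⟨_, (Nat.succ_pred p.natDegree_pos.ne').symm⟩
        have hn : (r + 1) * (d + 1) = n := by rw [← ht, primePowerDegree, hd]
        have hnum : ‖z ^ (r + 1) - z‖ ≤ 2 * ρ ^ (r + 1) := by
          refine (norm_sub_le _ _).trans ?_
          rw [norm_pow]
          have e1 : ‖z‖ ^ (r + 1) ≤ ρ ^ (r + 1) := by gcongr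
          have e2 : ρ ≤ ρ ^ (r + 1) := le_self_pow₀ h1 (by omega)
          linarith
        have hden : (1 : ℝ) ≤ ‖(r : ℂ) + 1‖ := by
          have : ‖(r : ℂ) + 1‖ = (r : ℝ) + 1 := by norm_cast
          rw [this]
          simp
        have hkey : (Fintype.card F : ℝ) ^ d ≤ ρ ^ ((r + 1) * d) := by
          rw [pow_mul]
          refine pow_le_pow_left₀ hq0.le (hρ.trans (pow_le_pow_right₀ h1 (by omega))) _
        calc ‖z ^ (r + 1) - z‖ / ‖(r : ℂ) + 1‖ / (Fintype.card F : ℝ) ^ n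
            ≤ 2 * ρ ^ (r + 1) / (Fintype.card F : ℝ) ^ n := by
              gcongr
              exact (div_le_self (norm_nonneg _) hden).trans hnum
          _ = ((Fintype.card F : ℝ) ^ (d + 1))⁻¹ * (2 * Fintype.card F *
                (ρ ^ (r + 1) * Fintype.card F ^ d / (Fintype.card F : ℝ) ^ n)) := by
              rw [pow_succ (Fintype.card F : ℝ) d]
              field_simp
          _ ≤ ((Fintype.card F : ℝ) ^ (d + 1))⁻¹ * (2 * Fintype.card F *
                (ρ ^ (r + 1) * ρ ^ ((r + 1) * d) / (Fintype.card F : ℝ) ^ n)) := by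
              gcongr
          _ = _ := by
              have hsplit : ρ ^ (r + 1) * ρ ^ ((r + 1) * d) = ρ ^ n := by
                rw [← pow_add, ← hn]
                congr 1
                ring
              rw [hd, div_pow, hsplit]
    _ ≤ (n + 1) * (2 * Fintype.card F * (ρ / Fintype.card F) ^ n) := by
        rw [← Finset.sum_mul]
        gcongr
        exact sum_primePowersOfDegree_le n
    _ = _ := by ring

/-- A bound for the prime power terms that is geometric in the degree and uniform for `‖z‖ ≤ ρ`. -/
theorem exists_sum_norm_logFactorTerm_le {ρ : ℝ} (h1 : 1 ≤ ρ) (hρ : (Fintype.card F : ℝ) ≤ ρ ^ 2)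
    (hρq : ρ < Fintype.card F) :
    ∃ (M : ℕ) (θ : ℝ), 0 < θ ∧ θ < 1 ∧ ∀ z : ℂ, ‖z‖ ≤ ρ → ∀ n : ℕ,
      ((n : ℝ) + 1) * ∑ t ∈ primePowersOfDegree F (n + 1), ‖logFactorTerm F z t‖ ≤
        M * θ ^ (n + 1) := by
  have hq := two_le_card_real F
  have hq0 : (0 : ℝ) < Fintype.card F := by linarith
  have hx0 : 0 < ρ / Fintype.card F := by positivity
  obtain ⟨θ, hθ1, hθ2⟩ := exists_between ((div_lt_one hq0).2 hρq)
  have hθ0 := hx0.trans hθ1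
  have hs := (summable_succ_pow_mul_geometric 2 (div_pos hx0 hθ0)
    ((div_lt_one hθ0).2 hθ1)).tendsto_atTop_zero
  obtain ⟨B, hB⟩ := hs.bddAbove_range
  obtain ⟨M, hM⟩ := exists_nat_ge (2 * Fintype.card F * B)
  refine ⟨M, θ, hθ0, hθ2, fun z hz n => ?_⟩
  have hBn := hB ⟨n + 1, rfl⟩
  simp only at hBn
  calc ((n : ℝ) + 1) * ∑ t ∈ primePowersOfDegree F (n + 1), ‖logFactorTerm F z t‖
      ≤ (((n + 1 : ℕ) : ℝ) + 1) * (2 * Fintype.card F * ((n + 1 : ℕ) + 1) *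
          (ρ / Fintype.card F) ^ (n + 1)) := by
        refine mul_le_mul ?_ (sum_norm_logFactorTerm_le h1 hρ hz _)
          (Finset.sum_nonneg fun _ _ => norm_nonneg _) (by positivity)
        push_cast
        linarith
    _ = 2 * Fintype.card F * ((((n + 1 : ℕ) : ℝ) + 1) ^ 2 *
          (ρ / Fintype.card F / θ) ^ (n + 1)) * θ ^ (n + 1) := by
        rw [div_pow _ θ]
        field_simp
    _ ≤ 2 * Fintype.card F * B * θ ^ (n + 1) := by gcongr
    _ ≤ M * θ ^ (n + 1) := by gcongr

theorem norm_mangoldtError_le {z : ℂ} {M : ℕ} {θ : ℝ}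
    (h : ∀ n : ℕ, ((n : ℝ) + 1) * ∑ t ∈ primePowersOfDegree F (n + 1), ‖logFactorTerm F z t‖ ≤
        M * θ ^ (n + 1)) (n : ℕ) :
    ‖mangoldtError F z (n + 1)‖ ≤ M * θ ^ (n + 1) := by
  have hn : (n : ℂ) + 1 ≠ 0 := by exact_mod_cast n.succ_ne_zero
  refine le_trans ?_ (h n)
  rw [← div_mul_cancel₀ (mangoldtError F z (n + 1)) hn, mangoldtError_div, norm_mul, mul_comm]
  have : ‖(n : ℂ) + 1‖ = (n : ℝ) + 1 := by norm_cast
  rw [this]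
  gcongr
  exact norm_sum_le _ _

/-- The Taylor series of the two logarithms in the local factor at `p`. -/
theorem hasSum_logFactorTerm {z : ℂ} (hz : ‖z‖ < Fintype.card F) (p : MonicIrreducible F) :
    HasSum (fun r => logFactorTerm F z (p, r))
      (Complex.log (1 - 1 / (Fintype.card F : ℂ) ^ p.1.natDegree) * z -
        Complex.log (1 - z / (Fintype.card F : ℂ) ^ p.1.natDegree)) := by
  have hq := two_le_card_real F
  have hQ : (Fintype.card F : ℝ) ≤ (Fintype.card F : ℝ) ^ p.1.natDegree :=
    le_self_pow₀ (by linarith) p.natDegree_pos.ne'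
  have hQ0 : (0 : ℝ) < (Fintype.card F : ℝ) ^ p.1.natDegree := by positivity
  have hn1 : ‖1 / (Fintype.card F : ℂ) ^ p.1.natDegree‖ < 1 := by
    rw [norm_div, norm_pow, Complex.norm_natCast, norm_one, div_lt_one hQ0]
    linarith
  have hn2 : ‖z / (Fintype.card F : ℂ) ^ p.1.natDegree‖ < 1 := by
    rw [norm_div, norm_pow, Complex.norm_natCast, div_lt_one hQ0]
    linarith
  have s1 := (hasSum_nat_add_iff' 1).2 (Complex.hasSum_taylorSeries_neg_log hn1)
  have s2 := (hasSum_nat_add_iff' 1).2 (Complex.hasSum_taylorSeries_neg_log hn2)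
  have h := s2.sub (s1.mul_left z)
  simp only [Finset.sum_range_one, Nat.cast_zero, div_zero, sub_zero] at h
  rw [show ∀ a b : ℂ, a * z - b = -b - z * -a from fun a b => by ring]
  have he : ∀ r, logFactorTerm F z (p, r) =
      (z / (Fintype.card F : ℂ) ^ p.1.natDegree) ^ (r + 1) / ((r + 1 : ℕ) : ℂ) -
        z * ((1 / (Fintype.card F : ℂ) ^ p.1.natDegree) ^ (r + 1) / ((r + 1 : ℕ) : ℂ)) :=
    fun r => by
    rw [logFactorTerm, primePowerDegree, mul_comm (r + 1), pow_mul, div_pow, div_pow, one_pow]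
    push_cast
    ring
  rw [funext he]
  exact h

theorem hasSum_subtype_primePowerDegree {E : Type*} [AddCommMonoid E] [TopologicalSpace E]
    (g : MonicIrreducible F × ℕ → E) (n : ℕ) :
    HasSum (fun t : {t : MonicIrreducible F × ℕ // primePowerDegree t = n} => g t)
      (∑ t ∈ primePowersOfDegree F n, g t) := by
  have : Fintype {t : MonicIrreducible F × ℕ // primePowerDegree t = n} :=
    Fintype.subtype (primePowersOfDegree F n) fun t => mem_primePowersOfDegree
  rw [Finset.sum_subtype (primePowersOfDegree F n) (fun t => mem_primePowersOfDegree) g]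
  exact hasSum_fintype _

theorem hasSum_logFactorTerm_of_bound {z : ℂ} {M : ℕ} {θ : ℝ} (hθ0 : 0 < θ) (hθ1 : θ < 1)
    (hb : ∀ n : ℕ, ((n : ℝ) + 1) * ∑ t ∈ primePowersOfDegree F (n + 1), ‖logFactorTerm F z t‖ ≤
        M * θ ^ (n + 1)) :
    HasSum (logFactorTerm F z) (∑' n : ℕ, mangoldtError F z (n + 1) / ((n : ℂ) + 1)) := by
  have hsn : Summable fun n : ℕ => ∑ t ∈ primePowersOfDegree F n, ‖logFactorTerm F z t‖ := by
    rw [← summable_nat_add_iff 1]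
    refine Summable.of_nonneg_of_le (fun n => Finset.sum_nonneg fun _ _ => norm_nonneg _)
      (fun n => ?_) ((summable_geometric_of_lt_one hθ0.le hθ1).mul_left (M * θ))
    refine le_trans (le_mul_of_one_le_left (Finset.sum_nonneg fun _ _ => norm_nonneg _)
      (by simp : (1 : ℝ) ≤ n + 1)) ((hb n).trans_eq ?_)
    ring
  have hsig : Summable fun x : (Σ n : ℕ, {t : MonicIrreducible F × ℕ // primePowerDegree t = n}) =>
      ‖logFactorTerm F z x.2.1‖ := by
    refine (summable_sigma_of_nonneg fun x => norm_nonneg _).2 ⟨fun n => ?_, ?_⟩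
    · exact (hasSum_subtype_primePowerDegree (fun t => ‖logFactorTerm F z t‖) n).summable
    · exact hsn.congr fun n =>
        ((hasSum_subtype_primePowerDegree (fun t => ‖logFactorTerm F z t‖) n).tsum_eq).symm
  have hs := hsig.of_norm.hasSum
  have h1 := hs.sigma fun n => hasSum_subtype_primePowerDegree (logFactorTerm F z) n
  have h2 := h1.tsum_eq
  rw [h1.summable.tsum_eq_zero_add, primePowersOfDegree_zero, Finset.sum_empty, zero_add] at h2
  simp only [mangoldtError_div]
  rw [h2]
  exact (Equiv.sigmaFiberEquiv (primePowerDegree (F := F))).hasSum_iff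
    (f := logFactorTerm F z) |>.1 hs

/-- The Euler product converges, and it is the value at `u = 1` of the series with logarithmic
derivative `∑ mangoldtError F z (n + 1) * u ^ n`: the absolutely convergent series over prime
powers is summed by primes and by degrees. -/
theorem hasProd_localFactor {ρ : ℝ} (h1 : 1 ≤ ρ) (hρ : (Fintype.card F : ℝ) ≤ ρ ^ 2)
    (hρq : ρ < Fintype.card F) {z : ℂ} (hz : ‖z‖ ≤ ρ) :
    HasProd (localFactor F z)
      (Complex.exp (∑' n : ℕ, mangoldtError F z (n + 1) / ((n : ℂ) + 1))) := by
  have hzq := hz.trans_lt hρq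
  have hq := two_le_card_real F
  obtain ⟨M, θ, hθ0, hθ1, hb⟩ := exists_sum_norm_logFactorTerm_le h1 hρ hρq
  have hb := hb z hz
  have hsum := hasSum_logFactorTerm_of_bound hθ0 hθ1 hb
  have hexp := (hsum.prod_fiberwise fun p => hasSum_logFactorTerm hzq p).cexp
  convert hexp using 1
  ext p
  have hQ : (Fintype.card F : ℝ) ≤ (Fintype.card F : ℝ) ^ p.1.natDegree :=
    le_self_pow₀ (by linarith) p.natDegree_pos.ne'
  have hne : ∀ w : ℂ, ‖w‖ < Fintype.card F →
      1 - w / (Fintype.card F : ℂ) ^ p.1.natDegree ≠ 0 := fun w hw h0 => by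
    have h := congrArg norm (sub_eq_zero.1 h0)
    rw [norm_one, norm_div, norm_pow, Complex.norm_natCast, eq_div_iff (by positivity)] at h
    linarith
  rw [Function.comp_apply, Complex.exp_sub, Complex.exp_log (hne z hzq), localFactor,
    Complex.cpow_def_of_ne_zero (hne 1 (by rw [norm_one]; linarith)), ← div_eq_mul_inv]

theorem multipliable_localFactor {z : ℂ} (hz : ‖z‖ < Fintype.card F) :
    Multipliable (localFactor F z) := by
  have hq := two_le_card_real F
  have hs : √(Fintype.card F : ℝ) < Fintype.card F := by
    rw [Real.sqrt_lt' (by linarith)]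
    nlinarith
  have h1 : 1 ≤ √(Fintype.card F : ℝ) := Real.one_le_sqrt.2 (by linarith)
  refine (hasProd_localFactor (ρ := max ‖z‖ √(Fintype.card F : ℝ)) (h1.trans (le_max_right _ _))
    ?_ (max_lt hz hs) (le_max_left _ _)).multipliable
  rw [← Real.sqrt_le_left (by positivity)]
  exact le_max_right _ _

/-! ### The generating polynomials for fixed `z` -/

/-- The power series `∑ (∑_{deg f = n} z ^ Ω(f)) (u / q) ^ n`. -/
noncomputable def omegaSeries (F : Type*) [Field F] [Fintype F] (z : ℂ) : PowerSeries ℂ :=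
  PowerSeries.mk fun n => (omegaPoly F n).eval z / (Fintype.card F : ℂ) ^ n

/-- The coefficients of `∑ z ^ Ω(f) (u / q) ^ deg f * (1 - u) ^ z`. -/
noncomputable def eulerCoeff (F : Type*) [Field F] [Fintype F] (z : ℂ) (n : ℕ) : ℂ :=
  PowerSeries.coeff n (omegaSeries F z * risingSeries (-z))

theorem derivative_omegaSeries (z : ℂ) :
    PowerSeries.derivative ℂ (omegaSeries F z) =
      PowerSeries.mk (fun i => twistedMangoldt F z (i + 1) / (Fintype.card F : ℂ) ^ (i + 1)) *
        omegaSeries F z := by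
  have hq : (Fintype.card F : ℂ) ≠ 0 := by exact_mod_cast Fintype.card_ne_zero
  ext n
  rw [PowerSeries.coeff_derivative, PowerSeries.coeff_mul, omegaSeries]
  simp only [PowerSeries.coeff_mk]
  have h := eval_omegaPoly_recurrence (F := F) z n
  push_cast at h
  rw [div_mul_eq_mul_div, mul_comm, h, Finset.sum_div]
  refine Finset.sum_congr rfl fun ij hij => ?_
  rw [← Finset.HasAntidiagonal.mem_antidiagonal.1 hij, add_right_comm, pow_add, div_mul_div_comm]

theorem eulerCoeff_zero (z : ℂ) : eulerCoeff F z 0 = 1 := by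
  simp [eulerCoeff, omegaSeries, risingSeries, risingBinom_zero_right, eval_omegaPoly_zero_left]

theorem eulerCoeff_recurrence (z : ℂ) (n : ℕ) :
    ((n : ℂ) + 1) * eulerCoeff F z (n + 1) = ∑ ij ∈ Finset.HasAntidiagonal.antidiagonal n,
      mangoldtError F z (ij.1 + 1) * eulerCoeff F z ij.2 := by
  have h : PowerSeries.derivative ℂ (omegaSeries F z * risingSeries (-z)) =
      PowerSeries.mk (fun i => mangoldtError F z (i + 1)) *
        (omegaSeries F z * risingSeries (-z)) := by
    have h1 : PowerSeries.mk (fun i => mangoldtError F z (i + 1)) =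
        PowerSeries.mk (fun i => twistedMangoldt F z (i + 1) / (Fintype.card F : ℂ) ^ (i + 1)) +
          PowerSeries.mk (fun _ => -z) := by
      ext i
      simp [mangoldtError, sub_eq_add_neg]
    rw [Derivation.leibniz, derivative_omegaSeries, derivative_risingSeries, h1]
    simp only [smul_eq_mul]
    ring
  have h2 := congrArg (PowerSeries.coeff n) h
  rw [PowerSeries.coeff_derivative, PowerSeries.coeff_mul n] at h2
  simp only [PowerSeries.coeff_mk] at h2
  rw [mul_comm]
  exact h2

/-- The factorization `A(u / q) = (1 - u) ^ (-z) G(u)` on coefficients. -/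
theorem eval_omegaPoly_div (z : ℂ) (n : ℕ) :
    (omegaPoly F n).eval z / (Fintype.card F : ℂ) ^ n =
      ∑ j ∈ Finset.range (n + 1), eulerCoeff F z j * risingBinom z (n - j) := by
  have h : omegaSeries F z = (omegaSeries F z * risingSeries (-z)) * risingSeries z := by
    rw [mul_assoc, mul_comm (risingSeries (-z)), risingSeries_mul_neg, mul_one]
  have h2 := congrArg (PowerSeries.coeff n) h
  rw [PowerSeries.coeff_mul, Finset.Nat.sum_antidiagonal_eq_sum_range_succ_mk] at h2
  simpa [omegaSeries, risingSeries, eulerCoeff] using h2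

theorem Complex.norm_one_add_le_exp (w : ℂ) : ‖1 + w‖ ≤ Real.exp (w.re + ‖w‖ ^ 2 / 2) := by
  refine le_of_sq_le_sq ?_ (Real.exp_pos _).le
  have h : ‖1 + w‖ ^ 2 = 2 * w.re + ‖w‖ ^ 2 + 1 := by
    rw [← Complex.normSq_eq_norm_sq, ← Complex.normSq_eq_norm_sq, Complex.normSq_apply,
      Complex.normSq_apply]
    simp
    ring
  rw [h, ← Real.exp_nat_mul]
  refine (Real.add_one_le_exp _).trans_eq ?_
  congr 1
  push_cast
  ring

theorem norm_risingBinom_succ_le {ρ : ℝ} {z : ℂ} (hz : ‖z‖ ≤ ρ) (m : ℕ) :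
    ‖risingBinom z (m + 1)‖ * (m + 1) ≤ ρ * Real.exp (z.re * (harmonic m : ℝ) +
      ρ ^ 2 * ∑ i ∈ Finset.range m, 1 / ((i : ℝ) + 1) ^ 2) := by
  induction m with
  | zero => simpa [risingBinom] using hz
  | succ m ih =>
    have hm : (0 : ℝ) < (m : ℝ) + 1 := by positivity
    have hm2 : ((m : ℂ) + 1) ≠ 0 := by exact_mod_cast m.succ_ne_zero
    have hm3 : ((m : ℂ) + 1 + 1) ≠ 0 := by exact_mod_cast (m + 1).succ_ne_zero
    have h1 : ‖risingBinom z (m + 1 + 1)‖ * (((m + 1 : ℕ) : ℝ) + 1) =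
        ‖risingBinom z (m + 1)‖ * (m + 1) * ‖1 + z / ((m : ℂ) + 1)‖ := by
      have e1 : ((m + 1 : ℕ) : ℝ) + 1 = ‖((m : ℂ) + 1 + 1)‖ := by norm_cast
      have e2 : (m : ℝ) + 1 = ‖(m : ℂ) + 1‖ := by norm_cast
      rw [e1, e2, ← norm_mul, ← norm_mul, ← norm_mul, risingBinom_succ z (m + 1)]
      push_cast
      congr 1
      field_simp
      ring
    have h2 : ‖1 + z / ((m : ℂ) + 1)‖ ≤
        Real.exp (z.re * (1 / ((m : ℝ) + 1)) + ρ ^ 2 * (1 / ((m : ℝ) + 1) ^ 2)) := by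
      refine (Complex.norm_one_add_le_exp _).trans (Real.exp_le_exp.2 ?_)
      have e1 : (z / ((m : ℂ) + 1)).re = z.re * (1 / ((m : ℝ) + 1)) := by
        rw [show z / ((m : ℂ) + 1) = z * ((1 / ((m : ℝ) + 1) : ℝ) : ℂ) by push_cast; ring,
          Complex.re_mul_ofReal]
      have e2 : ‖z / ((m : ℂ) + 1)‖ = ‖z‖ / ((m : ℝ) + 1) := by
        rw [norm_div]
        congr 1
        norm_cast
      rw [e1, e2, div_pow]
      have : ‖z‖ ^ 2 ≤ ρ ^ 2 := by gcongr
      have h3 : ‖z‖ ^ 2 / ((m : ℝ) + 1) ^ 2 ≤ ρ ^ 2 * (1 / ((m : ℝ) + 1) ^ 2) := by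
        rw [mul_one_div]
        gcongr
      have h4 : 0 ≤ ‖z‖ ^ 2 / ((m : ℝ) + 1) ^ 2 := by positivity
      linarith
    rw [h1, harmonic_succ, Finset.sum_range_succ]
    refine (mul_le_mul ih h2 (norm_nonneg _) ((by positivity : 0 ≤ ‖risingBinom z (m + 1)‖ *
      ((m : ℝ) + 1)).trans ih)).trans_eq ?_
    rw [mul_assoc, ← Real.exp_add]
    congr 2
    push_cast
    ring

/-- A uniform form of `risingBinom z m = O(m ^ (z - 1))`. -/
theorem exists_norm_risingBinom_le {ρ : ℝ} (hρ : 0 ≤ ρ) :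
    ∃ C : ℝ, 1 ≤ C ∧ ∀ z : ℂ, ‖z‖ ≤ ρ → ∀ m : ℕ,
      ‖risingBinom z (m + 1)‖ * (m + 1) ≤ C * Real.exp (z.re * Real.log (m + 1)) := by
  have hs : Summable fun i : ℕ => 1 / ((i : ℝ) + 1) ^ 2 := by
    have := (summable_nat_add_iff 1).2 (Real.summable_one_div_nat_pow.2 one_lt_two)
    simpa using this
  refine ⟨max 1 (ρ * Real.exp (ρ + ρ ^ 2 * ∑' i : ℕ, 1 / ((i : ℝ) + 1) ^ 2)), le_max_left _ _,
    fun z hz m => (norm_risingBinom_succ_le hz m).trans ?_⟩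
  have h1 : Real.log (m + 1) ≤ (harmonic m : ℝ) := by exact_mod_cast log_add_one_le_harmonic m
  have h2 : (harmonic m : ℝ) ≤ 1 + Real.log (m + 1) := by
    rcases Nat.eq_zero_or_pos m with rfl | hm
    · simp
    · refine (harmonic_le_one_add_log m).trans ?_
      have : Real.log m ≤ Real.log (m + 1) :=
        Real.log_le_log (by exact_mod_cast hm) (by linarith)
      linarith
  have hre := (Complex.abs_re_le_norm z).trans hz
  have h3 : z.re * (harmonic m : ℝ) ≤ z.re * Real.log (m + 1) + ρ := by
    have e1 : |(harmonic m : ℝ) - Real.log (m + 1)| ≤ 1 := by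
      rw [abs_le]; constructor <;> linarith
    have e2 : z.re * ((harmonic m : ℝ) - Real.log (m + 1)) ≤ ρ * 1 := by
      refine (le_abs_self _).trans ?_
      rw [abs_mul]
      exact mul_le_mul hre e1 (abs_nonneg _) hρ
    linarith
  have h4 := hs.sum_le_tsum (Finset.range m) fun _ _ => by positivity
  calc _ ≤ ρ * Real.exp ((z.re * Real.log (m + 1) + ρ) +
        ρ ^ 2 * ∑' i : ℕ, 1 / ((i : ℝ) + 1) ^ 2) := by gcongr
    _ = ρ * Real.exp (ρ + ρ ^ 2 * ∑' i : ℕ, 1 / ((i : ℝ) + 1) ^ 2) *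
        Real.exp (z.re * Real.log (m + 1)) := by
      rw [mul_assoc, ← Real.exp_add]
      congr 2
      ring
    _ ≤ _ := by gcongr; exact le_max_right _ _

/-- The bound that dominates the convolution `∑ j, γ j * risingBinom z (n - j)`: replacing `n - j`
by `n` in `n ^ (z - 1)` costs only a power of `j + 1`, since `n ≤ (j + 1) (n - j)`. -/
theorem exists_norm_risingBinom_sub_le {ρ : ℝ} (hρ : 0 ≤ ρ) :
    ∃ (C : ℝ) (K : ℕ), 0 ≤ C ∧ ∀ z : ℂ, ‖z‖ ≤ ρ → ∀ n : ℕ, 1 ≤ n → ∀ j : ℕ, j ≤ n →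
      ‖risingBinom z (n - j)‖ * (n * Real.exp (-(z.re * Real.log n))) ≤ C * ((j : ℝ) + 1) ^ K := by
  obtain ⟨C, hC1, hC⟩ := exists_norm_risingBinom_le hρ
  obtain ⟨K, hK⟩ := exists_nat_ge ρ
  have hexp : ∀ x y : ℝ, |x| ≤ ρ → 1 ≤ y → Real.exp (x * Real.log y) ≤ y ^ K := fun x y hx hy => by
    have hy0 : 0 < y := by linarith
    rw [← Real.rpow_natCast, Real.rpow_def_of_pos hy0, mul_comm x]
    exact Real.exp_le_exp.2 (mul_le_mul_of_nonneg_left (((le_abs_self _).trans hx).trans hK)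
      (Real.log_nonneg hy))
  refine ⟨C, K + 1, by linarith, fun z hz n hn j hj => ?_⟩
  have hre := (Complex.abs_re_le_norm z).trans hz
  have hn0 : (0 : ℝ) < n := by exact_mod_cast hn
  have hn1 : (1 : ℝ) ≤ n := by exact_mod_cast hn
  rcases Nat.lt_or_ge j n with hjn | hjn
  · obtain ⟨m, rfl⟩ : ∃ m, n = j + (m + 1) := ⟨n - j - 1, by omega⟩
    rw [Nat.add_sub_cancel_left]
    have hm0 : (0 : ℝ) < (m : ℝ) + 1 := by positivity
    have hj0 : (0 : ℝ) ≤ j := by positivity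
    set y : ℝ := (j + (m + 1) : ℕ) / ((m : ℝ) + 1) with hy
    have hy1 : 1 ≤ y := by
      rw [hy, one_le_div hm0]
      push_cast
      linarith
    have hyj : y ≤ j + 1 := by
      rw [hy, div_le_iff₀ hm0]
      push_cast
      nlinarith [(by positivity : (0 : ℝ) ≤ (j : ℝ) * m)]
    have hlog : Real.log y = Real.log (j + (m + 1) : ℕ) - Real.log (m + 1) := by
      rw [hy, Real.log_div hn0.ne' hm0.ne']
    calc ‖risingBinom z (m + 1)‖ *
          (((j + (m + 1) : ℕ) : ℝ) * Real.exp (-(z.re * Real.log (j + (m + 1) : ℕ))))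
        = (‖risingBinom z (m + 1)‖ * (m + 1)) * y *
          Real.exp (-(z.re * Real.log (j + (m + 1) : ℕ))) := by
          rw [hy]
          field_simp
      _ ≤ (C * Real.exp (z.re * Real.log (m + 1))) * y *
          Real.exp (-(z.re * Real.log (j + (m + 1) : ℕ))) := by
          have := hC z hz m
          gcongr ?_ * _ * _
      _ = C * (y * Real.exp (-z.re * Real.log y)) := by
          rw [hlog, show -z.re * (Real.log (j + (m + 1) : ℕ) - Real.log (m + 1)) =
            z.re * Real.log (m + 1) + -(z.re * Real.log (j + (m + 1) : ℕ)) by ring, Real.exp_add]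
          ring
      _ ≤ C * (y * y ^ K) := by
          gcongr
          exact hexp _ _ (by rwa [abs_neg]) hy1
      _ ≤ C * ((j : ℝ) + 1) ^ (K + 1) := by
          rw [← pow_succ']
          gcongr
  · obtain rfl : j = n := le_antisymm hj hjn
    rw [Nat.sub_self, risingBinom_zero_right, norm_one, one_mul]
    calc _ ≤ (j : ℝ) * (j : ℝ) ^ K := by
          gcongr
          rw [← neg_mul]
          exact hexp _ _ (by rwa [abs_neg]) hn1
      _ ≤ ((j : ℝ) + 1) ^ (K + 1) := by
          rw [← pow_succ']
          gcongr
          linarith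
      _ ≤ _ := le_mul_of_one_le_left (by positivity) hC1

/-- `risingBinom z n ~ n ^ (z - 1) / Γ(z)`: Euler's limit formula for the Gamma function. -/
theorem tendsto_risingBinom {z : ℂ} (hz : ∀ m : ℕ, z ≠ -m) :
    Tendsto (fun n : ℕ => risingBinom z n * (n * Complex.exp (-(z * Real.log n)))) atTop
      (𝓝 (Complex.Gamma z)⁻¹) := by
  have h1 : Tendsto (fun n : ℕ => (n : ℂ) / (n + z)) atTop (𝓝 1) := by
    exact tendsto_natCast_div_add_atTop z
  have h2 := h1.mul ((Complex.GammaSeq_tendsto_Gamma z).inv₀ (Complex.Gamma_ne_zero hz))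
  rw [one_mul] at h2
  refine h2.congr' ?_
  filter_upwards [eventually_ge_atTop 1] with n hn
  have hn0 : (n : ℂ) ≠ 0 := by exact_mod_cast (Nat.one_le_iff_ne_zero.1 hn)
  have hzn : z + n ≠ 0 := fun h => hz n (eq_neg_of_add_eq_zero_left h)
  have hf : (Nat.factorial n : ℂ) ≠ 0 := by exact_mod_cast n.factorial_ne_zero
  have hr : risingBinom z n = (∏ i ∈ Finset.range n, (z + i)) / Nat.factorial n := by
    rw [risingBinom, Finset.prod_div_distrib, ← Finset.prod_range_add_one_eq_factorial]
    push_cast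
    rfl
  rw [Complex.GammaSeq, Finset.prod_range_succ, hr, Complex.cpow_def_of_ne_zero hn0,
    Complex.exp_neg, Complex.ofReal_log (by positivity), Complex.ofReal_natCast, mul_comm z,
    add_comm (n : ℂ)]
  field_simp

/-- The shift by `j` does not affect the limit, as `(n + j) / n` tends to `1`. -/
theorem tendsto_risingBinom_sub {z : ℂ} (hz : ∀ m : ℕ, z ≠ -m) (j : ℕ) :
    Tendsto (fun n : ℕ => risingBinom z (n - j) * (n * Complex.exp (-(z * Real.log n)))) atTop
      (𝓝 (Complex.Gamma z)⁻¹) := by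
  rw [← tendsto_add_atTop_iff_nat j]
  have h1 : Tendsto (fun n : ℕ => ((n + j : ℕ) : ℝ) / n) atTop (𝓝 1) := by
    have h := (tendsto_const_div_atTop_nhds_zero_nat (j : ℝ)).const_add 1
    rw [add_zero] at h
    refine h.congr' ?_
    filter_upwards [eventually_ge_atTop 1] with n hn
    have hn0 : (n : ℝ) ≠ 0 := by exact_mod_cast (Nat.one_le_iff_ne_zero.1 hn)
    push_cast
    field_simp
  have h2 : Tendsto (fun n : ℕ => ((((n + j : ℕ) : ℝ) / n : ℝ) : ℂ) *
      Complex.exp (-(z * (Real.log (((n + j : ℕ) : ℝ) / n) : ℝ)))) atTop (𝓝 1) := by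
    have hl := (Real.continuousAt_log one_ne_zero).tendsto.comp h1
    rw [Real.log_one] at hl
    have hl2 := (((Complex.continuous_ofReal.tendsto _).comp hl).const_mul z).neg.cexp
    simpa using ((Complex.continuous_ofReal.tendsto _).comp h1).mul hl2
  have h3 := (tendsto_risingBinom hz).mul h2
  rw [mul_one] at h3
  refine h3.congr' ?_
  filter_upwards [eventually_ge_atTop 1] with n hn
  have hn0 : (n : ℝ) ≠ 0 := by exact_mod_cast (Nat.one_le_iff_ne_zero.1 hn)
  have hn1 : (n : ℂ) ≠ 0 := by exact_mod_cast hn0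
  have hnj : ((n + j : ℕ) : ℝ) ≠ 0 := by positivity
  rw [Nat.add_sub_cancel, Real.log_div hnj hn0, Complex.ofReal_sub, mul_sub, neg_sub,
    sub_eq_add_neg, Complex.exp_add, Complex.exp_neg]
  push_cast
  field_simp

/-- `n q ^ (-n) z⁻¹ n ^ (-z) ∑_{deg f = n} z ^ Ω(f)`, the quotient by `z` being taken in the
polynomial ring so that this is an entire function of `z` for `n ≥ 1`. -/
noncomputable def normalizedOmega (F : Type*) [Field F] [Fintype F] (n : ℕ) (z : ℂ) : ℂ :=
  n / (Fintype.card F : ℂ) ^ n * (omegaPoly F n).divX.eval z * Complex.exp (-(z * Real.log n))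

theorem normalizedOmega_mul {n : ℕ} (hn : 1 ≤ n) (z : ℂ) :
    normalizedOmega F n z * z = ∑' j : ℕ, if j ≤ n then
      eulerCoeff F z j *
      (risingBinom z (n - j) * (n * Complex.exp (-(z * Real.log n)))) else 0 := by
  have h1 : (omegaPoly F n).eval z = (omegaPoly F n).divX.eval z * z := by
    conv_lhs => rw [← divX_mul_X_add (omegaPoly F n)]
    rw [coeff_omegaPoly, numMonicWithOmega_zero_right (by omega)]
    simp
  rw [tsum_eq_sum (s := Finset.range (n + 1)) fun j hj =>
    if_neg (by simpa [Nat.lt_succ_iff] using hj)]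
  calc normalizedOmega F n z * z = (omegaPoly F n).eval z / (Fintype.card F : ℂ) ^ n *
        (n * Complex.exp (-(z * Real.log n))) := by
        rw [normalizedOmega, h1]
        ring
    _ = _ := by
        rw [eval_omegaPoly_div, Finset.sum_mul]
        refine Finset.sum_congr rfl fun j hj => ?_
        rw [if_pos (Nat.lt_succ_iff.1 (Finset.mem_range.1 hj)), mul_assoc]

/-- The summable majorant of the terms in `normalizedOmega_mul`. -/
theorem exists_summable_bound {ρ : ℝ} (h1 : 1 ≤ ρ) (hρ : (Fintype.card F : ℝ) ≤ ρ ^ 2)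
    (hρq : ρ < Fintype.card F) :
    ∃ b : ℕ → ℝ, Summable b ∧ ∀ z : ℂ, ‖z‖ ≤ ρ → ∀ n : ℕ, 1 ≤ n → ∀ j : ℕ,
      ‖if j ≤ n then eulerCoeff F z j *
        (risingBinom z (n - j) * (n * Complex.exp (-(z * Real.log n)))) else 0‖ ≤ b j := by
  obtain ⟨M, θ, hθ0, hθ1, hb⟩ := exists_sum_norm_logFactorTerm_le h1 hρ hρq
  obtain ⟨C, K, hC0, hC⟩ := exists_norm_risingBinom_sub_le (ρ := ρ) (by linarith)
  refine ⟨fun j => C * (((j : ℝ) + 1) ^ (M + K) * θ ^ j),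
    (summable_succ_pow_mul_geometric (M + K) hθ0 hθ1).mul_left C, fun z hz n hn j => ?_⟩
  split_ifs with hj
  · have e1 := norm_le_of_recurrence hθ0.le (eulerCoeff_zero z) (eulerCoeff_recurrence (F := F) z)
      (norm_mangoldtError_le (hb z hz)) j
    have e2 := hC z hz n hn j hj
    have e3 : ‖Complex.exp (-(z * Real.log n))‖ = Real.exp (-(z.re * Real.log n)) := by
      rw [Complex.norm_exp, Complex.neg_re, Complex.re_mul_ofReal]
    rw [norm_mul, norm_mul, norm_mul, e3, Complex.norm_natCast]
    calc _ ≤ (((j : ℝ) + 1) ^ M * θ ^ j) * (C * ((j : ℝ) + 1) ^ K) :=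
          mul_le_mul e1 e2 (by positivity) (by positivity)
      _ = C * (((j : ℝ) + 1) ^ (M + K) * θ ^ j) := by rw [pow_add]; ring
  · rw [norm_zero]
    positivity

theorem exists_norm_normalizedOmega_le {ρ : ℝ} (h1 : 1 ≤ ρ) (hρ : (Fintype.card F : ℝ) ≤ ρ ^ 2)
    (hρq : ρ < Fintype.card F) :
    ∃ B : ℝ, ∀ z : ℂ, ‖z‖ = ρ → ∀ n : ℕ, 1 ≤ n → ‖normalizedOmega F n z‖ ≤ B := by
  obtain ⟨b, hb, hbd⟩ := exists_summable_bound h1 hρ hρq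
  refine ⟨∑' j, b j, fun z hz n hn => ?_⟩
  calc ‖normalizedOmega F n z‖ ≤ ‖normalizedOmega F n z‖ * ‖z‖ :=
        le_mul_of_one_le_right (norm_nonneg _) (h1.trans_eq hz.symm)
    _ = ‖normalizedOmega F n z * z‖ := (norm_mul _ _).symm
    _ ≤ ∑' j, b j := by
        rw [normalizedOmega_mul hn]
        exact tsum_of_norm_bounded hb.hasSum (hbd z hz.le n hn)

/-- The Selberg-Delange asymptotic `∑_{deg f = n} z ^ Ω(f) ~ q ^ n n ^ (z - 1) z H(z)`. -/
theorem tendsto_normalizedOmega {ρ : ℝ} (h1 : 1 ≤ ρ) (hρ : (Fintype.card F : ℝ) ≤ ρ ^ 2)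
    (hρq : ρ < Fintype.card F) {z : ℂ} (hz : ‖z‖ ≤ ρ) (hzm : ∀ m : ℕ, z ≠ -m) :
    Tendsto (fun n => normalizedOmega F n z) atTop (𝓝 (satheSelbergH F z)) := by
  obtain ⟨b, hb, hbd⟩ := exists_summable_bound h1 hρ hρq
  obtain ⟨M, θ, hθ0, hθ1, hM⟩ := exists_sum_norm_logFactorTerm_le h1 hρ hρq
  have hz0 : z ≠ 0 := by simpa using hzm 0
  have hlim := tendsto_tsum_of_dominated_convergence (𝓕 := atTop) (bound := b)
    (f := fun (n : ℕ) (j : ℕ) => if j ≤ n then eulerCoeff F z j *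
        (risingBinom z (n - j) * (n * Complex.exp (-(z * Real.log n)))) else 0)
    (g := fun j => eulerCoeff F z j * (Complex.Gamma z)⁻¹) hb
    (fun j => by
      refine ((tendsto_risingBinom_sub hzm j).const_mul (eulerCoeff F z j)).congr' ?_
      filter_upwards [eventually_ge_atTop j] with n hn
      rw [if_pos hn])
    (by filter_upwards [eventually_ge_atTop 1] with n hn j using hbd z hz n hn j)
  have hval : (∑' j, eulerCoeff F z j * (Complex.Gamma z)⁻¹) / z = satheSelbergH F z := by
    rw [tsum_mul_right, tsum_eq_exp_of_recurrence hθ0 hθ1 (eulerCoeff_zero z)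
      (eulerCoeff_recurrence (F := F) z) (norm_mangoldtError_le (hM z hz)), satheSelbergH,
      (hasProd_localFactor h1 hρ hρq hz).tprod_eq, Complex.Gamma_add_one z hz0, mul_inv]
    field_simp
  rw [← hval]
  refine (hlim.div_const z).congr' ?_
  filter_upwards [eventually_ge_atTop 1] with n hn
  rw [← normalizedOmega_mul hn, mul_div_cancel_right₀ _ hz0]

/-- `H` is bounded below because the exponent in its Euler product is bounded uniformly. -/
theorem exists_le_norm_satheSelbergH {ρ : ℝ} (h1 : 1 ≤ ρ) (hρ : (Fintype.card F : ℝ) ≤ ρ ^ 2)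
    (hρq : ρ < Fintype.card F) :
    ∃ c : ℝ, 0 < c ∧ ∀ x : ℝ, 0 ≤ x → x ≤ ρ → c ≤ ‖satheSelbergH F (x : ℂ)‖ := by
  obtain ⟨M, θ, hθ0, hθ1, hM⟩ := exists_sum_norm_logFactorTerm_le h1 hρ hρq
  have hcont : ContinuousOn (fun x : ℝ => Real.Gamma (x + 1)) (Set.Icc 0 ρ) := fun x hx =>
    ((Real.differentiableAt_Gamma fun m => by
      have : (0 : ℝ) ≤ m := m.cast_nonneg
      linarith [hx.1]).continuousAt.comp
      (by fun_prop : ContinuousAt (fun x : ℝ => x + 1) x)).continuousWithinAt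
  obtain ⟨G, hG⟩ := isCompact_Icc.exists_bound_of_continuousOn hcont
  have hG0 : 0 < G := (norm_pos_iff.2 (by simp)).trans_le (hG 0 ⟨le_rfl, by linarith⟩)
  have hgeo : HasSum (fun n : ℕ => M * θ * θ ^ n) (M * θ * (1 - θ)⁻¹) :=
    (hasSum_geometric_of_lt_one hθ0.le hθ1).mul_left _
  refine ⟨G⁻¹ * Real.exp (-(M * θ * (1 - θ)⁻¹)), by positivity, fun x hx0 hxρ => ?_⟩
  have hxn : ‖(x : ℂ)‖ ≤ ρ := by rwa [Complex.norm_real, Real.norm_of_nonneg hx0]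
  have hsum : ‖∑' n : ℕ, mangoldtError F x (n + 1) / ((n : ℂ) + 1)‖ ≤ M * θ * (1 - θ)⁻¹ := by
    refine tsum_of_norm_bounded hgeo fun n => ?_
    have e1 : ‖(n : ℂ) + 1‖ = (n : ℝ) + 1 := by norm_cast
    rw [norm_div, e1]
    refine (div_le_self (norm_nonneg _) (by simp)).trans
      ((norm_mangoldtError_le (hM x hxn) n).trans_eq ?_)
    ring
  rw [satheSelbergH, (hasProd_localFactor h1 hρ hρq hxn).tprod_eq, norm_mul, norm_inv,
    Complex.norm_exp]
  have hGx : Complex.Gamma ((x : ℂ) + 1) = (Real.Gamma (x + 1) : ℝ) := by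
    rw [← Complex.Gamma_ofReal]
    push_cast
    rfl
  have hpos : 0 < Real.Gamma (x + 1) := Real.Gamma_pos_of_pos (by linarith)
  gcongr
  · rw [hGx, Complex.norm_real]
    exact norm_pos_iff.2 hpos.ne'
  · rw [hGx, Complex.norm_real]
    exact hG x ⟨hx0, hxρ⟩
  · exact (abs_le.1 ((Complex.abs_re_le_norm _).trans hsum)).1

/-! ### Extraction of the coefficients in `z` -/

theorem hasFPowerSeriesAt_of_hasSum {a : ℕ → ℂ} {φ : ℂ → ℂ}
    (h : ∀ z, HasSum (fun s => a s * z ^ s) (φ z)) :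
    HasFPowerSeriesAt φ (FormalMultilinearSeries.ofScalars ℂ a) 0 := by
  refine ⟨1, ?_, one_pos, fun {z} _ => ?_⟩
  · refine mod_cast FormalMultilinearSeries.le_radius_of_summable_norm (r := 1) _ ?_
    simpa [FormalMultilinearSeries.ofScalars_norm] using (h 1).summable.norm
  · simpa [FormalMultilinearSeries.ofScalars_apply_eq, mul_comm] using h z

theorem eq_of_hasSum_mul_pow {a b : ℕ → ℂ} {φ : ℂ → ℂ}
    (ha : ∀ z, HasSum (fun s => a s * z ^ s) (φ z))
    (hb : ∀ z, HasSum (fun s => b s * z ^ s) (φ z)) : a = b :=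
  FormalMultilinearSeries.ofScalars_series_injective ℂ ℂ
    ((hasFPowerSeriesAt_of_hasSum ha).eq_formalMultilinearSeries (hasFPowerSeriesAt_of_hasSum hb))

/-- Cauchy's integral for the Taylor coefficient of index `s` at the origin. -/
noncomputable def cauchyCoeff (f : ℂ → ℂ) (ρ : ℝ) (s : ℕ) : ℂ :=
  (2 * Real.pi * Complex.I : ℂ)⁻¹ • ∮ z in C(0, ρ), (z ^ (s + 1))⁻¹ * f z

theorem hasSum_cauchyCoeff {f : ℂ → ℂ} (hf : Differentiable ℂ f) {ρ : ℝ} (hρ : 0 < ρ) (z : ℂ) :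
    HasSum (fun s => cauchyCoeff f ρ s * z ^ s) (f z) := by
  lift ρ to NNReal using hρ.le
  have h := (hf.hasFPowerSeriesOnBall 0 (R := ρ) (by exact_mod_cast hρ)).hasSum
    (y := z) (by simp)
  rw [zero_add] at h
  have he : ∀ s, (cauchyPowerSeries f 0 ρ).coeff s = cauchyCoeff f ρ s := fun s => by
    refine (cauchyPowerSeries_apply f 0 ρ s 1).trans ?_
    rw [cauchyCoeff]
    congr 2
    ext w
    simp only [sub_zero, one_div, smul_eq_mul]
    rw [pow_succ, mul_inv, inv_pow, mul_assoc]
  simp only [FormalMultilinearSeries.apply_eq_pow_smul_coeff, he] at h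
  simpa only [smul_eq_mul, mul_comm] using h

theorem norm_cauchyCoeff_le {f : ℂ → ℂ} {ρ B : ℝ} (hρ : 0 < ρ) (hB : ∀ z, ‖z‖ = ρ → ‖f z‖ ≤ B)
    (s : ℕ) : ‖cauchyCoeff f ρ s‖ ≤ B * (ρ ^ s)⁻¹ := by
  refine (circleIntegral.norm_two_pi_i_inv_smul_integral_le_of_norm_le_const
    (C := (ρ ^ (s + 1))⁻¹ * B) hρ.le fun z hz => ?_).trans_eq ?_
  · rw [mem_sphere_zero_iff_norm] at hz
    rw [norm_mul, norm_inv, norm_pow, hz]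
    gcongr
    exact hB z hz
  · rw [pow_succ]
    field_simp

theorem tendsto_cauchyCoeff {f : ℕ → ℂ → ℂ} {g : ℂ → ℂ} {ρ B : ℝ} (hρ : 0 < ρ)
    (hf : ∀ n, Continuous (f n)) (hB : ∀ z, ‖z‖ = ρ → ∀ n, 1 ≤ n → ‖f n z‖ ≤ B)
    (hlim : ∀ z, ‖z‖ = ρ → Tendsto (fun n => f n z) atTop (𝓝 (g z))) (s : ℕ) :
    Tendsto (fun n => cauchyCoeff (f n) ρ s) atTop (𝓝 (cauchyCoeff g ρ s)) := by
  have hn : ∀ θ : ℝ, ‖circleMap 0 ρ θ‖ = ρ := fun θ => by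
    rw [norm_circleMap_zero, abs_of_pos hρ]
  have hne : ∀ θ : ℝ, circleMap 0 ρ θ ^ (s + 1) ≠ 0 := fun θ => by
    rw [← norm_ne_zero_iff, norm_pow, hn]
    positivity
  have hd : ∀ θ : ℝ, ‖deriv (circleMap 0 ρ) θ‖ = ρ := fun θ => by
    rw [deriv_circleMap, norm_mul, hn, Complex.norm_I, mul_one]
  simp only [cauchyCoeff, smul_eq_mul]
  refine Tendsto.const_mul _ ?_
  simp only [circleIntegral, smul_eq_mul]
  refine intervalIntegral.tendsto_integral_filter_of_dominated_convergence
    (fun _ => ρ * ((ρ ^ (s + 1))⁻¹ * B)) ?_ ?_ (by simp) ?_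
  · refine Eventually.of_forall fun n => Continuous.aestronglyMeasurable ?_
    refine Continuous.mul ?_ (Continuous.mul ?_ ((hf n).comp (continuous_circleMap 0 ρ)))
    · rw [show deriv (circleMap 0 ρ) = fun θ => circleMap 0 ρ θ * Complex.I from
        funext fun θ => deriv_circleMap 0 ρ θ]
      exact (continuous_circleMap 0 ρ).mul continuous_const
    · exact ((continuous_circleMap 0 ρ).pow _).inv₀ hne
  · filter_upwards [eventually_ge_atTop 1] with n h1
    refine Eventually.of_forall fun θ _ => ?_
    rw [norm_mul, norm_mul, norm_inv, norm_pow, hd, hn]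
    gcongr
    exact hB _ (hn θ) n h1
  · exact Eventually.of_forall fun θ _ => ((hlim _ (hn θ)).const_mul _).const_mul _

theorem differentiable_normalizedOmega (n : ℕ) : Differentiable ℂ (normalizedOmega F n) := by
  unfold normalizedOmega
  fun_prop

theorem hasSum_mul_pow_mul_exp {f : ℂ → ℂ} {a : ℕ → ℂ}
    (hf : ∀ z, HasSum (fun s => a s * z ^ s) (f z)) (L z : ℂ) :
    HasSum (fun m => (∑ ij ∈ Finset.HasAntidiagonal.antidiagonal m,
      a ij.1 * (L ^ ij.2 / Nat.factorial ij.2)) * z ^ m) (f z * Complex.exp (z * L)) := by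
  have he : HasSum (fun t : ℕ => (z * L) ^ t / (Nat.factorial t : ℂ)) (Complex.exp (z * L)) := by
    rw [Complex.exp_eq_exp_ℂ]
    exact NormedSpace.expSeries_div_hasSum_exp (z * L)
  have h1 := (hf z).summable.norm
  have h2 := he.summable.norm
  have h3 := (summable_norm_sum_mul_antidiagonal_of_summable_norm h1 h2).of_norm.hasSum
  rw [← tsum_mul_tsum_eq_tsum_sum_antidiagonal_of_summable_norm h1 h2, (hf z).tsum_eq,
    he.tsum_eq] at h3
  have e : ∀ m, (∑ ij ∈ Finset.HasAntidiagonal.antidiagonal m,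
      a ij.1 * (L ^ ij.2 / (Nat.factorial ij.2 : ℂ))) * z ^ m =
      ∑ ij ∈ Finset.HasAntidiagonal.antidiagonal m,
        a ij.1 * z ^ ij.1 * ((z * L) ^ ij.2 / (Nat.factorial ij.2 : ℂ)) := fun m => by
    rw [Finset.sum_mul]
    refine Finset.sum_congr rfl fun ij hij => ?_
    rw [← Finset.HasAntidiagonal.mem_antidiagonal.1 hij, pow_add, mul_pow]
    ring
  rw [funext e]
  exact h3

/-- Comparison of the coefficients of `z ^ m` in `normalizedOmega F n z * n ^ z`, which is a
polynomial. -/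
theorem numMonicWithOmega_eq_sum {ρ : ℝ} (hρ : 0 < ρ) (n m : ℕ) :
    (n : ℂ) / (Fintype.card F : ℂ) ^ n * numMonicWithOmega F n (m + 1) =
      ∑ ij ∈ Finset.HasAntidiagonal.antidiagonal m, cauchyCoeff (normalizedOmega F n) ρ ij.1 *
        ((Real.log n : ℂ) ^ ij.2 / Nat.factorial ij.2) := by
  have h1 : ∀ z : ℂ, HasSum (fun m => ((n : ℂ) / (Fintype.card F : ℂ) ^ n *
      numMonicWithOmega F n (m + 1)) * z ^ m)
      (normalizedOmega F n z * Complex.exp (z * Real.log n)) := fun z => by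
    have e : normalizedOmega F n z * Complex.exp (z * Real.log n) =
        n / (Fintype.card F : ℂ) ^ n * (omegaPoly F n).divX.eval z := by
      rw [normalizedOmega, mul_assoc, ← Complex.exp_add, neg_add_cancel, Complex.exp_zero, mul_one]
    rw [e]
    simp only [mul_assoc]
    refine HasSum.mul_left _ ?_
    rw [eval_eq_sum_range]
    simp only [← coeff_omegaPoly, ← coeff_divX]
    refine hasSum_sum_of_ne_finset_zero fun i hi => ?_
    rw [coeff_eq_zero_of_natDegree_lt (by simpa [Nat.lt_succ_iff] using hi), zero_mul]
  have h2 := hasSum_mul_pow_mul_exp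
    (hasSum_cauchyCoeff (differentiable_normalizedOmega (F := F) n) hρ) (Real.log n : ℂ)
  exact congrFun (eq_of_hasSum_mul_pow h1 h2) m

/-- The quotient of `N(n, m + 1)` by `q ^ n / n * (log n) ^ m / m!`. The descending factorial
vanishes for `s > m`, so the series is a finite sum. -/
theorem numMonicWithOmega_ratio {ρ : ℝ} (hρ : 0 < ρ) {n : ℕ} (hL : 0 < Real.log n) (m : ℕ) :
    (n : ℂ) / (Fintype.card F : ℂ) ^ n * numMonicWithOmega F n (m + 1) *
        Nat.factorial m / (Real.log n : ℂ) ^ m =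
      ∑' s : ℕ, cauchyCoeff (normalizedOmega F n) ρ s *
        (((m.descFactorial s : ℝ) / Real.log n ^ s : ℝ) : ℂ) := by
  have hL0 : (Real.log n : ℂ) ≠ 0 := by exact_mod_cast hL.ne'
  rw [tsum_eq_sum (s := Finset.range (m + 1)) fun s hs => by
    rw [Nat.descFactorial_of_lt (by simpa [Nat.lt_succ_iff] using hs)]; simp]
  rw [numMonicWithOmega_eq_sum hρ, Finset.Nat.sum_antidiagonal_eq_sum_range_succ
    (fun i j => cauchyCoeff (normalizedOmega F n) ρ i *
        ((Real.log n : ℂ) ^ j / Nat.factorial j)), Finset.sum_mul, Finset.sum_div]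
  refine Finset.sum_congr rfl fun s hs => ?_
  have hsm : s ≤ m := Nat.lt_succ_iff.1 (Finset.mem_range.1 hs)
  have hf : (Nat.factorial (m - s) : ℂ) ≠ 0 := by exact_mod_cast (m - s).factorial_ne_zero
  rw [← Nat.factorial_mul_descFactorial hsm]
  conv_lhs => rw [show (Real.log n : ℂ) ^ m = (Real.log n : ℂ) ^ (m - s) * (Real.log n : ℂ) ^ s by
    rw [← pow_add, Nat.sub_add_cancel hsm]]
  simp only [Complex.ofReal_div, Complex.ofReal_pow, Complex.ofReal_natCast, Nat.cast_mul]
  field_simp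

theorem descFactorial_div_le {σ L : ℝ} (hL : 0 < L) {m : ℕ}
    (hm : ((m + 1 : ℕ) : ℝ) ≤ σ * L) (s : ℕ) :
    (m.descFactorial s : ℝ) / L ^ s ≤ σ ^ s := by
  rw [div_le_iff₀ (by positivity), ← mul_pow]
  push_cast at hm
  calc (m.descFactorial s : ℝ) ≤ (m : ℝ) ^ s := by exact_mod_cast Nat.descFactorial_le_pow m s
    _ ≤ _ := by gcongr; linarith

theorem exists_abs_descFactorial_div_sub_le {σ : ℝ} (hσ : 0 < σ) (s : ℕ) :
    ∃ C : ℝ, ∀ L : ℝ, 0 < L → ∀ m : ℕ, ((m + 1 : ℕ) : ℝ) ≤ σ * L →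
      |(m.descFactorial s : ℝ) / L ^ s - (((m + 1 : ℕ) : ℝ) / L) ^ s| ≤ C / L := by
  induction s with
  | zero => exact ⟨0, fun L hL m _ => by simp⟩
  | succ s ih =>
    obtain ⟨C, hC⟩ := ih
    refine ⟨C * σ + σ ^ s * (s + 1), fun L hL m hm => ?_⟩
    have h1 := hC L hL m hm
    have h2 := descFactorial_div_le hL hm s
    have hx : ((m + 1 : ℕ) : ℝ) / L ≤ σ := by rwa [div_le_iff₀ hL]
    have hx0 : 0 ≤ ((m + 1 : ℕ) : ℝ) / L := by positivity
    have h3 : |(((m - s : ℕ) : ℝ)) / L - ((m + 1 : ℕ) : ℝ) / L| ≤ (s + 1) / L := by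
      rw [← sub_div, abs_div, abs_of_pos hL]
      gcongr
      have e1 : ((m - s : ℕ) : ℝ) ≤ m := by exact_mod_cast Nat.sub_le m s
      have e2 : (m : ℝ) ≤ (m - s : ℕ) + s := by exact_mod_cast (by omega : m ≤ (m - s) + s)
      have e3 : (0 : ℝ) ≤ s := s.cast_nonneg
      push_cast
      rw [abs_le]
      constructor <;> linarith
    set u := (m.descFactorial s : ℝ) / L ^ s with hu
    have hu0 : 0 ≤ u := by positivity
    set x := ((m + 1 : ℕ) : ℝ) / L
    have e : (m.descFactorial (s + 1) : ℝ) / L ^ (s + 1) - x ^ (s + 1) =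
        (u - x ^ s) * x + u * (((m - s : ℕ) : ℝ) / L - x) := by
      rw [Nat.descFactorial_succ, hu]
      push_cast
      field_simp
      ring
    rw [e]
    calc _ ≤ |u - x ^ s| * |x| + |u| * |((m - s : ℕ) : ℝ) / L - x| := by
          rw [← abs_mul, ← abs_mul]
          exact abs_add_le _ _
      _ ≤ C / L * σ + σ ^ s * ((s + 1) / L) := by
          rw [abs_of_nonneg hx0, abs_of_nonneg hu0]
          have := (abs_nonneg _).trans h1
          gcongr
      _ = _ := by ring

/-- Transfer from an asymptotic for the generating polynomials to one for their coefficients: the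
Taylor coefficients of `f n` on a disc of radius `ρ > σ` converge, and each descending factorial
quotient is close to `((m + 1) / L) ^ s`. The filter expresses that `n → ∞` uniformly in
`m + 1 ≤ σ * L n`. -/
theorem tendsto_tsum_descFactorial {f : ℕ → ℂ → ℂ} {H : ℂ → ℂ} {ρ σ B : ℝ} (hσ : 0 < σ)
    (hσρ : σ < ρ) (hf : ∀ n, Differentiable ℂ (f n))
    (hB : ∀ z, ‖z‖ = ρ → ∀ n, 1 ≤ n → ‖f n z‖ ≤ B)
    (hlim : ∀ z, ‖z‖ = ρ → Tendsto (fun n => f n z) atTop (𝓝 (H z)))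
    (hlim' : ∀ x : ℝ, 0 < x → x ≤ σ → Tendsto (fun n => f n x) atTop (𝓝 (H x)))
    {L : ℕ → ℝ} (hL : Tendsto L atTop atTop) :
    Tendsto (fun p : ℕ × ℕ => ∑' s : ℕ, cauchyCoeff (f p.1) ρ s *
        (((p.2.descFactorial s : ℝ) / L p.1 ^ s : ℝ) : ℂ) -
        H ((((p.2 + 1 : ℕ) : ℝ) / L p.1 : ℝ) : ℂ))
      (comap Prod.fst atTop ⊓ 𝓟 {p | ((p.2 + 1 : ℕ) : ℝ) ≤ σ * L p.1}) (𝓝 0) := by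
  have hρ : 0 < ρ := hσ.trans hσρ
  set h := cauchyCoeff H ρ with hh
  have hBH : ∀ z, ‖z‖ = ρ → ‖H z‖ ≤ B := fun z hz => by
    refine le_of_tendsto (hlim z hz).norm ?_
    filter_upwards [eventually_ge_atTop 1] with n hn using hB z hz n hn
  have hB0 : 0 ≤ B := (norm_nonneg _).trans (hBH ρ (by simp [abs_of_pos hρ]))
  have hb1 : ∀ n, 1 ≤ n → ∀ s, ‖cauchyCoeff (f n) ρ s‖ ≤ B * (ρ ^ s)⁻¹ := fun n hn s =>
    norm_cauchyCoeff_le hρ (fun z hz => hB z hz n hn) s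
  have hb2 : ∀ s, ‖h s‖ ≤ B * (ρ ^ s)⁻¹ := norm_cauchyCoeff_le hρ hBH
  have hc : ∀ s, Tendsto (fun n => cauchyCoeff (f n) ρ s) atTop (𝓝 (h s)) :=
    tendsto_cauchyCoeff hρ (fun n => (hf n).continuous) hB hlim
  have hgeo : Summable fun s : ℕ => B * (σ / ρ) ^ s :=
    (summable_geometric_of_lt_one (by positivity) ((div_lt_one hρ).2 hσρ)).mul_left B
  have hterm : ∀ (a : ℂ) (y : ℝ) (s : ℕ), ‖a‖ ≤ B * (ρ ^ s)⁻¹ → 0 ≤ y → y ≤ σ ^ s →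
      ‖a * (y : ℂ)‖ ≤ B * (σ / ρ) ^ s := fun a y s ha hy0 hy => by
    rw [norm_mul, Complex.norm_real, Real.norm_of_nonneg hy0, div_pow]
    calc _ ≤ B * (ρ ^ s)⁻¹ * σ ^ s := by gcongr
      _ = _ := by ring
  -- The limit is the sum of its Cauchy coefficients, as a limit of entire functions.
  have hH : ∀ x : ℝ, 0 < x → x ≤ σ → HasSum (fun s => h s * ((x ^ s : ℝ) : ℂ)) (H x) :=
    fun x hx0 hxσ => by
    have hs : Summable fun s => h s * ((x ^ s : ℝ) : ℂ) :=
      Summable.of_norm_bounded hgeo fun s => hterm _ _ s (hb2 s) (by positivity) (by gcongr)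
    have ht := tendsto_tsum_of_dominated_convergence (𝓕 := atTop) hgeo
      (f := fun n s => cauchyCoeff (f n) ρ s * ((x ^ s : ℝ) : ℂ))
      (g := fun s => h s * ((x ^ s : ℝ) : ℂ)) (fun s => (hc s).mul_const _) (by
        filter_upwards [eventually_ge_atTop 1] with n hn s
        exact hterm _ _ s (hb1 n hn s) (by positivity) (by gcongr))
    have hv : ∀ n, ∑' s, cauchyCoeff (f n) ρ s * ((x ^ s : ℝ) : ℂ) = f n x := fun n => by
      rw [← (hasSum_cauchyCoeff (hf n) hρ x).tsum_eq]
      push_cast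
      rfl
    simp only [hv] at ht
    rw [tendsto_nhds_unique (hlim' x hx0 hxσ) ht]
    exact hs.hasSum
  have hfst : Tendsto Prod.fst
      (comap Prod.fst atTop ⊓ 𝓟 {p : ℕ × ℕ | ((p.2 + 1 : ℕ) : ℝ) ≤ σ * L p.1}) atTop :=
    tendsto_comap.mono_left inf_le_left
  have hmem : ∀ᶠ p : ℕ × ℕ in comap Prod.fst atTop ⊓
      𝓟 {p : ℕ × ℕ | ((p.2 + 1 : ℕ) : ℝ) ≤ σ * L p.1},
      1 ≤ p.1 ∧ 0 < L p.1 ∧ ((p.2 + 1 : ℕ) : ℝ) ≤ σ * L p.1 := by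
    filter_upwards [hfst.eventually (eventually_ge_atTop 1),
      hfst.eventually (hL.eventually_gt_atTop 0),
      (eventually_principal.2 fun p hp => hp :
        ∀ᶠ p : ℕ × ℕ in 𝓟 {p : ℕ × ℕ | ((p.2 + 1 : ℕ) : ℝ) ≤ σ * L p.1},
          p ∈ {p : ℕ × ℕ | ((p.2 + 1 : ℕ) : ℝ) ≤ σ * L p.1}).filter_mono inf_le_right]
      with p h1 h2 h3 using ⟨h1, h2, h3⟩
  have hmain := tendsto_tsum_of_dominated_convergence
    (𝓕 := comap Prod.fst atTop ⊓ 𝓟 {p : ℕ × ℕ | ((p.2 + 1 : ℕ) : ℝ) ≤ σ * L p.1})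
    (f := fun (p : ℕ × ℕ) (s : ℕ) =>
      cauchyCoeff (f p.1) ρ s * (((p.2.descFactorial s : ℝ) / L p.1 ^ s : ℝ) : ℂ) -
        h s * (((((p.2 + 1 : ℕ) : ℝ) / L p.1) ^ s : ℝ) : ℂ))
    (g := fun _ => 0) (hgeo.add hgeo) (fun s => ?_) ?_
  · rw [tsum_zero] at hmain
    refine hmain.congr' ?_
    filter_upwards [hmem] with p ⟨hp1, hp2, hp3⟩
    have hx0 : 0 < ((p.2 + 1 : ℕ) : ℝ) / L p.1 := by positivity
    have hs := hH _ hx0 ((div_le_iff₀ hp2).2 hp3)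
    rw [← hs.tsum_eq]
    refine Summable.tsum_sub ?_ hs.summable
    exact Summable.of_norm_bounded hgeo fun s =>
      hterm _ _ s (hb1 _ hp1 s) (by positivity) (descFactorial_div_le hp2 hp3 s)
  · obtain ⟨C, hC⟩ := exists_abs_descFactorial_div_sub_le hσ s
    have hz : Tendsto (fun n => ‖cauchyCoeff (f n) ρ s - h s‖ * σ ^ s + ‖h s‖ * (C / L n))
        atTop (𝓝 0) := by
      have h1 := (tendsto_iff_norm_sub_tendsto_zero.1 (hc s)).mul_const (σ ^ s)
      have h2 := (hL.const_div_atTop C).const_mul ‖h s‖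
      simpa using h1.add h2
    refine squeeze_zero_norm' ?_ (hz.comp hfst)
    filter_upwards [hmem] with p ⟨hp1, hp2, hp3⟩
    have e : ∀ a b u x : ℂ, a * u - b * x = (a - b) * u + b * (u - x) := fun a b u x => by ring
    rw [e, ← Complex.ofReal_sub]
    refine (norm_add_le _ _).trans ?_
    rw [norm_mul, norm_mul, Complex.norm_real, Complex.norm_real, Function.comp_apply,
      Real.norm_of_nonneg (by positivity)]
    gcongr
    · exact descFactorial_div_le hp2 hp3 s
    · exact hC _ hp2 _ hp3
  · filter_upwards [hmem] with p ⟨hp1, hp2, hp3⟩ s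
    refine (norm_sub_le _ _).trans (add_le_add ?_ ?_)
    · exact hterm _ _ s (hb1 _ hp1 s) (by positivity) (descFactorial_div_le hp2 hp3 s)
    · refine hterm _ _ s (hb2 s) (by positivity) ?_
      have := (div_le_iff₀ hp2).2 hp3
      gcongr

end

theorem theorem1p1 (F : Type*) [Field F] [Fintype F] :
    (∀ z : ℂ, ‖z‖ < (Fintype.card F : ℝ) → Multipliable (localFactor F z)) ∧
    ∀ ε : ℝ, 0 < ε → ε < (Fintype.card F : ℝ) →
      ∀ δ : ℝ, 0 < δ → ∃ n₀ : ℕ, ∀ n : ℕ, n₀ ≤ n → ∀ k : ℕ, 1 ≤ k →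
        (k : ℝ) ≤ ((Fintype.card F : ℝ) - ε) * Real.log n →
        ‖(numMonicWithOmega F n k : ℂ) /
            ((Fintype.card F : ℂ) ^ n / (n : ℂ) *
              satheSelbergH F (((k : ℝ) / Real.log n : ℝ) : ℂ) *
              ((Real.log n : ℝ) : ℂ) ^ (k - 1) / (Nat.factorial (k - 1) : ℂ)) - 1‖ < δ := by
  refine ⟨fun z hz => multipliable_localFactor hz, fun ε hε hεq δ hδ => ?_⟩
  have hq := two_le_card_real F
  -- A radius beyond `q - ε` that is not an integer, so that its circle avoids the poles of `Γ`.
  set ρ : ℝ := Fintype.card F - min ε 1 / 2 with hρ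
  have hmin0 : 0 < min ε 1 := lt_min hε one_pos
  have hmin1 : min ε 1 ≤ 1 := min_le_right _ _
  have hminε : min ε 1 ≤ ε := min_le_left _ _
  have hρ1 : 1 ≤ ρ := by linarith
  have hρ2 : (Fintype.card F : ℝ) ≤ ρ ^ 2 := by nlinarith
  have hρq : ρ < Fintype.card F := by linarith
  have hσ : 0 < (Fintype.card F : ℝ) - ε := by linarith
  have hσρ : (Fintype.card F : ℝ) - ε < ρ := by linarith
  have hpole : ∀ z : ℂ, ‖z‖ = ρ → ∀ m : ℕ, z ≠ -m := by
    rintro z hz m rfl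
    rw [norm_neg, Complex.norm_natCast] at hz
    have e1 : m < Fintype.card F := by
      have : (m : ℝ) < Fintype.card F := by linarith
      exact_mod_cast this
    have e2 : (m : ℝ) + 1 ≤ Fintype.card F := by exact_mod_cast e1
    linarith
  obtain ⟨B, hB⟩ := exists_norm_normalizedOmega_le hρ1 hρ2 hρq
  obtain ⟨c, hc0, hc⟩ := exists_le_norm_satheSelbergH hρ1 hρ2 hρq
  have hlim := tendsto_tsum_descFactorial (f := normalizedOmega F) (H := satheSelbergH F) hσ hσρ
    differentiable_normalizedOmega hB
    (fun z hz => tendsto_normalizedOmega hρ1 hρ2 hρq hz.le (hpole z hz))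
    (fun x hx0 hxσ => tendsto_normalizedOmega hρ1 hρ2 hρq
      (by rw [Complex.norm_real, Real.norm_of_nonneg hx0.le]; linarith)
      (fun m hm => by
        have h1 : x = -(m : ℝ) := by exact_mod_cast hm
        have h2 : (0 : ℝ) ≤ m := m.cast_nonneg
        linarith))
    (L := fun n => Real.log n) (Real.tendsto_log_atTop.comp tendsto_natCast_atTop_atTop)
  have hev := (tendsto_zero_iff_norm_tendsto_zero.1 hlim).eventually (gt_mem_nhds (mul_pos hc0 hδ))
  rw [eventually_inf_principal, eventually_comap] at hev
  obtain ⟨n₁, hn₁⟩ := eventually_atTop.1 hev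
  refine ⟨max n₁ 2, fun n hn k hk hkn => ?_⟩
  have hn2 : 2 ≤ n := (le_max_right _ _).trans hn
  have hL : 0 < Real.log n := Real.log_pos (by exact_mod_cast hn2)
  obtain ⟨m, rfl⟩ : ∃ m, k = m + 1 := ⟨k - 1, by omega⟩
  have h := hn₁ n ((le_max_left _ _).trans hn) (n, m) rfl hkn
  simp only [← numMonicWithOmega_ratio (F := F) (by linarith : 0 < ρ) hL m] at h
  have hx0 : 0 ≤ ((m + 1 : ℕ) : ℝ) / Real.log n := by positivity
  have hHc := hc _ hx0 (((div_le_iff₀ hL).2 hkn).trans hσρ.le)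
  have hH0 : satheSelbergH F ((((m + 1 : ℕ) : ℝ) / Real.log n : ℝ) : ℂ) ≠ 0 :=
    norm_pos_iff.1 (hc0.trans_le hHc)
  have hn0 : (n : ℂ) ≠ 0 := by exact_mod_cast (by omega : n ≠ 0)
  have hq0 : (Fintype.card F : ℂ) ≠ 0 := by exact_mod_cast Fintype.card_ne_zero
  have hL0 : (Real.log n : ℂ) ≠ 0 := by exact_mod_cast hL.ne'
  have hf0 : (Nat.factorial m : ℂ) ≠ 0 := by exact_mod_cast m.factorial_ne_zero
  rw [Nat.add_sub_cancel]
  generalize satheSelbergH F ((((m + 1 : ℕ) : ℝ) / Real.log n : ℝ) : ℂ) = H at *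
  have e : (numMonicWithOmega F n (m + 1) : ℂ) /
      ((Fintype.card F : ℂ) ^ n / (n : ℂ) * H * (Real.log n : ℂ) ^ m / (Nat.factorial m : ℂ)) - 1 =
      ((n : ℂ) / (Fintype.card F : ℂ) ^ n * numMonicWithOmega F n (m + 1) *
        Nat.factorial m / (Real.log n : ℂ) ^ m - H) / H := by
    field_simp
  rw [e, norm_div, div_lt_iff₀ (hc0.trans_le hHc)]
  calc _ < c * δ := h
    _ ≤ _ := by rw [mul_comm]; gcongr
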